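/- Let $K\subset\mathbb{R}^n$ and let $(T_t)_{t\in[0,1]}$ be a continuously contracting family of maps $T_t:K\to\mathbb{R}^n$: $T_0$ is the identity on $K$, each trajectory $t\mapsto T_t(x)$ ($x\in K$) is a curve $[0,1]\to\mathbb{R}^n$, and for all $x,y\in K$ the Euclidean distance $\|T_t(x)-T_t(y)\|_2$ is nonincreasing in $t\in[0,1]$. Assume that all trajectories are smooth ($C^\infty$ on $[0,1]$). Let $X$ be a $K$-valued random vector with $\mathbb{E}\|X\|_2<\infty$ and $$\mathbb{E}\,\sup_{t\in[0,1]}\Big\|\frac{\mathrm{d}}{\mathrm{d}t}T_t(X)\Big\|_2<\infty .$$ Let $s>0$ and let $Z$ be a standard Gaussian random vector in $\mathbb{R}^n$ independent of $X$. Then for every $t\in[0,1]$ the random vector $T_t(X)+\sqrt{s}\,Z$ has a density $f_{T_t(X)+\sqrt{s}Z}$ with respect to Lebesgue measure, and for every convex function $\phi:[0,\infty)\to\mathbb{R}$ with $\phi(0)=0$ the integral $$\int_{\mathbb{R}^n}\phi\big(f_{T_t(X)+\sqrt{s}Z}(x)\big)\,\mathrm{d}x\in[-\infty,\infty)$$ is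 well defined (the positive part of the integrand is integrable) and is nondecreasing in $t\in[0,1]$. -/

import Mathlib

open MeasureTheory ProbabilityTheory Set
open scoped ENNReal

/-- `T t`, for `t ∈ [0, 1]`, is a continuously contracting family of maps starting in the set `K`.
Only the values `T t x` with `t ∈ [0, 1]` and `x ∈ K` matter; `fun t ↦ T t x` is the trajectory
of `x`. That each `T t` is `1`-Lipschitz on `K` follows from the fields. -/
structure IsContinuouslyContracting {n : ℕ} (K : Set (EuclideanSpace ℝ (Fin n)))
    (T : ℝ → EuclideanSpace ℝ (Fin n) → EuclideanSpace ℝ (Fin n)) : Prop where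
  start : ∀ x ∈ K, T 0 x = x
  continuous_trajectory : ∀ x ∈ K, ContinuousOn (fun t => T t x) (Icc 0 1)
  antitone_dist : ∀ x ∈ K, ∀ y ∈ K, AntitoneOn (fun t => ‖T t x - T t y‖) (Icc 0 1)

/-- The trajectories `t ↦ T t x`, `x ∈ K`, are smooth (`C^∞`) on `[0, 1]`. -/
def HasSmoothTrajectories {n : ℕ} (K : Set (EuclideanSpace ℝ (Fin n)))
    (T : ℝ → EuclideanSpace ℝ (Fin n) → EuclideanSpace ℝ (Fin n)) : Prop :=
  ∀ x ∈ K, ContDiffOn ℝ ((⊤ : ℕ∞) : WithTop ℕ∞) (fun t => T t x) (Icc 0 1)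

/-- The extended-real valued Lebesgue integral `∫ h⁺ dμ - ∫ h⁻ dμ` of a real function `h`; it is
meaningful when at least one of the two terms is finite. -/
noncomputable def extIntegral {α : Type*} [MeasurableSpace α] (μ : Measure α) (h : α → ℝ) :
    EReal :=
  ((∫⁻ x, ENNReal.ofReal (h x) ∂μ : ℝ≥0∞) : EReal) -
    ((∫⁻ x, ENNReal.ofReal (-h x) ∂μ : ℝ≥0∞) : EReal)

/-- The (real-valued) density `f_Y` of a random vector `Y` with respect to Lebesgue measure. -/
noncomputable def density {Ω : Type*} [MeasurableSpace Ω] (P : Measure Ω) {n : ℕ}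
    (Y : Ω → EuclideanSpace ℝ (Fin n)) (x : EuclideanSpace ℝ (Fin n)) : ℝ :=
  (pdf Y P volume x).toReal

/-! Put `Y = T_t(X)`, `V = d/dt T_t(X)`, and let `k` be the density of `√s Z`. Then `f = 𝔼 k(x - Y)`
is the density sought, and it obeys the continuity equation `∂ₜ f = -div m` with momentum `m = 𝔼 k(x
- Y) V`. So `f` is transported by the averaged velocity `m / f`, and the heart of the proof is that
this field is compressing. With `p = 𝔼 k(x - Y)(x - Y) = -s ∇f` and `W = 𝔼 k(x - Y)⟪x - Y, V⟫ = -s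
div m`, one has `f² div(m / f) = -s⁻¹ (f W - ⟪p, m⟫)`. Symmetrizing over an independent copy `(Y',
V')` gives `f W - ⟪p, m⟫ = -½ 𝔼 𝔼' k k' ⟪Y - Y', V - V'⟫ ≥ 0`, since distances do not increase
(`inner_smoothedDisplacement_smoothedMomentum_le`).

A density carried by a compressing field grows along the flow. In weak form, for nondecreasing `q`
vanishing near `0`, integration by parts turns `d/dt ∫ f q(f)` into `s⁻¹ ∫ q'(f) (f W - ⟪p, m⟫) ≥
0`. Letting `q` tend to indicators of half-lines shows that `f` evaluated at a point of law `f dx`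
is stochastically nondecreasing in `t` (`monotoneOn_withDensity_preimage`).

Finally `∫ φ(f) = ∫ f · (φ(f) / f)`, where `φ(u) / u` is nondecreasing by convexity and `φ 0 = 0`.
Subtracting from its value at a uniform bound `M` of the densities leaves a nonnegative antitone
function, so the layer cake formula applies and infinite values are harmless. -/

open Filter Topology InnerProductSpace RealInnerProductSpace

/-! ### The Gaussian kernel and the density of a smoothed vector. -/

section GaussianKernel

variable {E : Type*} [NormedAddCommGroup E] [InnerProductSpace ℝ E] [FiniteDimensional ℝ E]
  [MeasurableSpace E] [BorelSpace E]

/-- The density at `x` of the centred Gaussian vector with covariance `s • 1`. -/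
noncomputable def gaussianKernel (s : ℝ) (x : E) : ℝ :=
  (∫ y : E, Real.exp (-(2 * s)⁻¹ * ‖y‖ ^ 2))⁻¹ * Real.exp (-(2 * s)⁻¹ * ‖x‖ ^ 2)

theorem integrable_exp_neg_mul_sq_norm {b : ℝ} (hb : 0 < b) :
    Integrable (fun y : E => Real.exp (-b * ‖y‖ ^ 2)) := by
  have h := (GaussianFourier.integrable_cexp_neg_mul_sq_norm_add (V := E) (b := (b : ℂ))
    (by simpa using hb) 0 0).norm
  refine h.congr (ae_of_all _ fun y => ?_)
  simp [Complex.norm_exp, ← Complex.ofReal_pow]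

variable {s : ℝ}

theorem gaussianKernel_normalization_pos (hs : 0 < s) :
    0 < ∫ y : E, Real.exp (-(2 * s)⁻¹ * ‖y‖ ^ 2) :=
  integral_exp_pos (integrable_exp_neg_mul_sq_norm (by positivity))

theorem gaussianKernel_pos (hs : 0 < s) (x : E) : 0 < gaussianKernel s x :=
  mul_pos (inv_pos.2 (gaussianKernel_normalization_pos hs)) (Real.exp_pos _)

theorem continuous_gaussianKernel (s : ℝ) : Continuous (gaussianKernel s : E → ℝ) := by
  unfold gaussianKernel; fun_prop

theorem integrable_gaussianKernel (hs : 0 < s) : Integrable (gaussianKernel s : E → ℝ) :=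
  (integrable_exp_neg_mul_sq_norm (by positivity)).const_mul _

theorem integral_gaussianKernel (hs : 0 < s) : ∫ x : E, gaussianKernel s x = 1 := by
  unfold gaussianKernel
  rw [integral_const_mul, inv_mul_cancel₀ (gaussianKernel_normalization_pos hs).ne']

theorem hasFDerivAt_gaussianKernel (s : ℝ) (x : E) :
    HasFDerivAt (gaussianKernel s) (-(s⁻¹ * gaussianKernel s x) • innerSL ℝ x) x := by
  have h : HasFDerivAt (fun x : E => -(2 * s)⁻¹ * ‖x‖ ^ 2) ((-s⁻¹) • innerSL ℝ x) x := by
    refine ((hasStrictFDerivAt_norm_sq x).hasFDerivAt.const_mul (-(2 * s)⁻¹)).congr_fderiv ?_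
    ext u
    simp
    ring
  refine (h.exp.const_mul _).congr_fderiv ?_
  ext u
  simp [gaussianKernel]
  ring

theorem hasFDerivAt_gaussianKernel_sub (s : ℝ) (y x : E) :
    HasFDerivAt (fun x => gaussianKernel s (x - y))
      (-(s⁻¹ * gaussianKernel s (x - y)) • innerSL ℝ (x - y)) x :=
  HasFDerivAt.comp (g := gaussianKernel s) (f := fun x => x - y) x
    (hasFDerivAt_gaussianKernel s (x - y)) ((hasFDerivAt_id x).sub_const y)

/-- The weight `1 + ‖x‖` lets one constant control the kernel, its gradient and, with a first
moment, the decay of the smoothed density at infinity. -/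
theorem exists_one_add_norm_mul_gaussianKernel_le (hs : 0 < s) :
    ∃ C : ℝ, 0 ≤ C ∧ ∀ x : E, (1 + ‖x‖) * gaussianKernel s x ≤ C := by
  have hc := inv_pos.2 (gaussianKernel_normalization_pos (E := E) hs)
  refine ⟨(∫ y : E, Real.exp (-(2 * s)⁻¹ * ‖y‖ ^ 2))⁻¹ * (2 + s / 2), by positivity, fun x => ?_⟩
  unfold gaussianKernel
  rw [mul_left_comm]
  gcongr
  have h1 : (2 * s)⁻¹ * ‖x‖ ^ 2 + 1 ≤ Real.exp ((2 * s)⁻¹ * ‖x‖ ^ 2) := Real.add_one_le_exp _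
  have h2 : ‖x‖ ≤ (2 * s)⁻¹ * ‖x‖ ^ 2 + s / 2 := by
    have : (2 * s)⁻¹ * ‖x‖ ^ 2 + s / 2 - ‖x‖ = (2 * s)⁻¹ * (‖x‖ - s) ^ 2 := by
      field_simp; ring
    have h3 : 0 ≤ (2 * s)⁻¹ * (‖x‖ - s) ^ 2 := by positivity
    linarith
  rw [neg_mul, Real.exp_neg, ← div_eq_mul_inv, div_le_iff₀ (Real.exp_pos _)]
  have h4 : 0 ≤ (2 * s)⁻¹ * ‖x‖ ^ 2 := by positivity
  nlinarith

theorem map_sqrt_smul_stdGaussian (hs : 0 < s) :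
    (stdGaussian E).map (fun z => √s • z) =
      volume.withDensity (fun x => ENNReal.ofReal (gaussianKernel s x)) := by
  have hprob : IsProbabilityMeasure
      ((volume : Measure E).withDensity (fun x => ENNReal.ofReal (gaussianKernel s x))) := by
    refine ⟨?_⟩
    rw [withDensity_apply _ .univ, setLIntegral_univ, ← ofReal_integral_eq_lintegral_ofReal (integrable_gaussianKernel hs)
      (ae_of_all _ fun x => (gaussianKernel_pos hs x).le), integral_gaussianKernel hs,
      ENNReal.ofReal_one]
  have hprob' : IsProbabilityMeasure ((stdGaussian E).map (fun z => √s • z)) :=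
    Measure.isProbabilityMeasure_map (by fun_prop)
  refine Measure.ext_of_charFun (funext fun t => ?_)
  have hb : 0 < ((((2 * s)⁻¹ : ℝ) : ℂ)).re := by rw [Complex.ofReal_re]; positivity
  -- The same formula with coefficient `I` gives the Fourier integral and with `0` the
  -- normalization; the common factor cancels in the quotient and is never evaluated.
  have h1 := GaussianFourier.integral_cexp_neg_mul_sq_norm_add (V := E) hb Complex.I t
  have h0 := GaussianFourier.integral_cexp_neg_mul_sq_norm_add (V := E) hb 0 t
  have hN : ((∫ y : E, Real.exp (-(2 * s)⁻¹ * ‖y‖ ^ 2) : ℝ) : ℂ) =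
      ∫ v : E, Complex.exp (-(((2 * s)⁻¹ : ℝ) : ℂ) * ‖v‖ ^ 2 + 0 * ⟪t, v⟫_ℝ) := by
    rw [← integral_complex_ofReal]
    congr 1 with v
    push_cast
    ring_nf
  have hN0 : ((∫ y : E, Real.exp (-(2 * s)⁻¹ * ‖y‖ ^ 2) : ℝ) : ℂ) ≠ 0 :=
    Complex.ofReal_ne_zero.2 (gaussianKernel_normalization_pos hs).ne'
  rw [charFun_map_smul, charFun_stdGaussian, charFun_apply,
    integral_withDensity_eq_integral_toReal_smul
      (continuous_gaussianKernel s).measurable.ennreal_ofReal (by simp)]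
  have h2 : ∫ x : E, (ENNReal.ofReal (gaussianKernel s x)).toReal •
      Complex.exp (⟪x, t⟫_ℝ * Complex.I) =
      ((∫ y : E, Real.exp (-(2 * s)⁻¹ * ‖y‖ ^ 2) : ℝ) : ℂ)⁻¹ *
      ∫ v : E, Complex.exp (-(((2 * s)⁻¹ : ℝ) : ℂ) * ‖v‖ ^ 2 + Complex.I * ⟪t, v⟫_ℝ) := by
    rw [← integral_const_mul]
    congr 1 with x
    rw [ENNReal.toReal_ofReal (gaussianKernel_pos hs x).le, gaussianKernel, Complex.real_smul,
      Complex.ofReal_mul, Complex.ofReal_inv, mul_assoc, Complex.exp_add, real_inner_comm,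
      mul_comm Complex.I]
    push_cast
    ring
  rw [h2, h1]
  rw [hN, h0] at hN0 ⊢
  have h3 : Complex.exp (0 ^ 2 * (‖t‖ : ℂ) ^ 2 / (4 * (((2 * s)⁻¹ : ℝ) : ℂ))) = 1 := by simp
  rw [h3, mul_one] at hN0 ⊢
  rw [inv_mul_cancel_left₀ hN0]
  congr 1
  rw [norm_smul, Real.norm_eq_abs, abs_of_nonneg (Real.sqrt_nonneg s)]
  push_cast
  rw [mul_pow, ← Complex.ofReal_pow (√s), Real.sq_sqrt hs.le, Complex.I_sq]
  have : (s : ℂ) ≠ 0 := Complex.ofReal_ne_zero.2 hs.ne'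
  field_simp
  ring

/-- The density at `x` of `Y + √s • Z`, for a standard Gaussian vector `Z` independent of `Y`. -/
noncomputable def smoothedDensity {Ω : Type*} [MeasurableSpace Ω] (P : Measure Ω) (s : ℝ)
    (Y : Ω → E) (x : E) : ℝ :=
  ∫ ω, gaussianKernel s (x - Y ω) ∂P

variable {Ω : Type*} [MeasurableSpace Ω] {P : Measure Ω} {Y Z : Ω → E}

theorem integrable_gaussianKernel_sub [IsProbabilityMeasure P] (hs : 0 < s) (hY : AEMeasurable Y P)
    (x : E) : Integrable (fun ω => gaussianKernel s (x - Y ω)) P := by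
  obtain ⟨C, -, hC⟩ := exists_one_add_norm_mul_gaussianKernel_le (E := E) hs
  refine .of_bound ((continuous_gaussianKernel s).measurable.comp_aemeasurable
    (aemeasurable_const.sub hY)).aestronglyMeasurable C (ae_of_all _ fun ω => ?_)
  rw [Real.norm_of_nonneg (gaussianKernel_pos hs _).le]
  refine le_trans ?_ (hC (x - Y ω))
  exact le_mul_of_one_le_left (gaussianKernel_pos hs _).le (by simp)

theorem ofReal_smoothedDensity [IsProbabilityMeasure P] (hs : 0 < s) (hY : AEMeasurable Y P)
    (x : E) : ENNReal.ofReal (smoothedDensity P s Y x) =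
      ∫⁻ y, ENNReal.ofReal (gaussianKernel s (x - y)) ∂P.map Y := by
  rw [smoothedDensity, ofReal_integral_eq_lintegral_ofReal (integrable_gaussianKernel_sub hs hY x)
    (ae_of_all _ fun ω => (gaussianKernel_pos hs _).le), lintegral_map' _ hY]
  exact ((continuous_gaussianKernel s).comp
    (continuous_const.sub continuous_id)).measurable.ennreal_ofReal.aemeasurable

theorem map_add_sqrt_smul_stdGaussian [IsProbabilityMeasure P] (hs : 0 < s)
    (hY : AEMeasurable Y P) (hZ : HasLaw Z (stdGaussian E) P) (hYZ : IndepFun Y Z P) :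
    P.map (fun ω => Y ω + √s • Z ω) =
      volume.withDensity (fun x => ENNReal.ofReal (smoothedDensity P s Y x)) := by
  have hW : AEMeasurable (fun ω => √s • Z ω) P := hZ.aemeasurable.const_smul _
  have hind : IndepFun Y (fun ω => √s • Z ω) P :=
    hYZ.comp measurable_id (measurable_const_smul (√s))
  have hmapW : P.map (fun ω => √s • Z ω) =
      volume.withDensity (fun x => ENNReal.ofReal (gaussianKernel s x)) := by
    rw [← map_sqrt_smul_stdGaussian hs, ← hZ.map_eq,
      AEMeasurable.map_map_of_aemeasurable (by fun_prop) hZ.aemeasurable]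
    rfl
  have hprob : IsProbabilityMeasure (P.map Y) := Measure.isProbabilityMeasure_map hY
  have hk : Measurable fun p : E × E => ENNReal.ofReal (gaussianKernel s (p.1 - p.2)) :=
    ((continuous_gaussianKernel s).comp (continuous_fst.sub continuous_snd)).measurable.ennreal_ofReal
  have hk1 : Measurable fun p : E => ENNReal.ofReal (gaussianKernel s p) :=
    (continuous_gaussianKernel s).measurable.ennreal_ofReal
  have hadd := hind.map_add_eq_map_conv_map₀ hY hW
  change P.map (fun ω => Y ω + √s • Z ω) = _ at hadd
  rw [hadd, hmapW]
  ext A hA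
  have hind1 : Measurable (A.indicator (1 : E → ℝ≥0∞)) := measurable_one.indicator hA
  rw [← lintegral_indicator_one hA, Measure.lintegral_conv hind1, withDensity_apply _ hA]
  simp_rw [ofReal_smoothedDensity hs hY]
  refine Eq.trans ?_ (lintegral_lintegral_swap (f := fun y x => ENNReal.ofReal
    (gaussianKernel s (x - y))) (hk.comp measurable_swap).aemeasurable)
  refine lintegral_congr fun y => ?_
  -- For fixed `y`, both sides agree after translating the Lebesgue integral by `y`.
  rw [lintegral_withDensity_eq_lintegral_mul _ hk1 (by fun_prop), ← lintegral_indicator hA,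
    ← lintegral_add_left_eq_self (A.indicator _) y]
  refine lintegral_congr fun x => ?_
  by_cases hx : y + x ∈ A <;> simp [hx]

end GaussianKernel

/-! ### The averaged velocity field and its divergence. -/

section Smoothing

variable {E : Type*} [NormedAddCommGroup E] [InnerProductSpace ℝ E] [FiniteDimensional ℝ E]
  [MeasurableSpace E] [BorelSpace E]
  {Ω : Type*} [MeasurableSpace Ω] {P : Measure Ω} {s : ℝ} {Y V : Ω → E}

/-- The smoothed displacement `x ↦ 𝔼 k(x - Y) (x - Y)`, which is `-s` times the gradient of the
smoothed density. -/
noncomputable def smoothedDisplacement (P : Measure Ω) (s : ℝ) (Y : Ω → E) (x : E) : E :=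
  ∫ ω, gaussianKernel s (x - Y ω) • (x - Y ω) ∂P

/-- The smoothed momentum `x ↦ 𝔼 k(x - Y) V`. -/
noncomputable def smoothedMomentum (P : Measure Ω) (s : ℝ) (Y V : Ω → E) (x : E) : E :=
  ∫ ω, gaussianKernel s (x - Y ω) • V ω ∂P

/-- The smoothed work `x ↦ 𝔼 k(x - Y) ⟪x - Y, V⟫`, which is `-s` times the divergence of the
smoothed momentum. -/
noncomputable def smoothedWork (P : Measure Ω) (s : ℝ) (Y V : Ω → E) (x : E) : ℝ :=
  ∫ ω, gaussianKernel s (x - Y ω) * ⟪x - Y ω, V ω⟫_ℝ ∂P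

theorem exists_gaussianKernel_bound (E : Type*) [NormedAddCommGroup E] [InnerProductSpace ℝ E]
    [FiniteDimensional ℝ E] [MeasurableSpace E] [BorelSpace E] (hs : 0 < s) :
    ∃ C : ℝ, 0 ≤ C ∧ (∀ x : E, (1 + ‖x‖) * gaussianKernel s x ≤ C) ∧
      (∀ x : E, |gaussianKernel s x| ≤ C) ∧
      (∀ x : E, ‖gaussianKernel s x • x‖ ≤ C) ∧
      ∀ x v : E, |gaussianKernel s x * ⟪x, v⟫_ℝ| ≤ C * ‖v‖ := by
  obtain ⟨C, hC0, hC⟩ := exists_one_add_norm_mul_gaussianKernel_le (E := E) hs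
  have h2 : ∀ x : E, ‖gaussianKernel s x • x‖ ≤ C := fun x => by
    rw [norm_smul, Real.norm_of_nonneg (gaussianKernel_pos hs x).le]
    nlinarith [hC x, gaussianKernel_pos hs x]
  refine ⟨C, hC0, hC, fun x => ?_, h2, fun x v => ?_⟩
  · rw [abs_of_pos (gaussianKernel_pos hs x)]
    nlinarith [hC x, gaussianKernel_pos hs x, norm_nonneg x]
  · rw [← real_inner_smul_left]
    exact (abs_real_inner_le_norm _ _).trans (by gcongr; exact h2 x)

theorem aestronglyMeasurable_gaussianKernel_sub (hY : AEMeasurable Y P) (x : E) :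
    AEStronglyMeasurable (fun ω => gaussianKernel s (x - Y ω)) P :=
  ((continuous_gaussianKernel s).measurable.comp_aemeasurable
    (aemeasurable_const.sub hY)).aestronglyMeasurable

theorem integrable_gaussianKernel_smul_sub [IsFiniteMeasure P] (hs : 0 < s) (hY : AEMeasurable Y P)
    (x : E) : Integrable (fun ω => gaussianKernel s (x - Y ω) • (x - Y ω)) P := by
  obtain ⟨C, -, -, -, hC, -⟩ := exists_gaussianKernel_bound E hs
  exact .of_bound ((aestronglyMeasurable_gaussianKernel_sub hY x).smul
    (aemeasurable_const.sub hY).aestronglyMeasurable) C (ae_of_all _ fun ω => hC _)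

theorem integrable_gaussianKernel_smul (hs : 0 < s) (hY : AEMeasurable Y P)
    (hV : Integrable V P) (x : E) : Integrable (fun ω => gaussianKernel s (x - Y ω) • V ω) P := by
  obtain ⟨C, -, -, hC, -⟩ := exists_gaussianKernel_bound E hs
  exact hV.bdd_smul (C := C) (aestronglyMeasurable_gaussianKernel_sub hY x)
    (ae_of_all _ fun ω => hC _)

theorem aestronglyMeasurable_gaussianKernel_mul_inner (hY : AEMeasurable Y P)
    (hV : AEStronglyMeasurable V P) (x : E) :
    AEStronglyMeasurable (fun ω => gaussianKernel s (x - Y ω) * ⟪x - Y ω, V ω⟫_ℝ) P :=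
  (aestronglyMeasurable_gaussianKernel_sub hY x).mul
    ((aemeasurable_const.sub hY).aestronglyMeasurable.inner hV)

theorem integrable_gaussianKernel_mul_inner (hs : 0 < s) (hY : AEMeasurable Y P)
    (hV : Integrable V P) (x : E) :
    Integrable (fun ω => gaussianKernel s (x - Y ω) * ⟪x - Y ω, V ω⟫_ℝ) P := by
  obtain ⟨C, -, -, -, -, hC⟩ := exists_gaussianKernel_bound E hs
  exact (hV.norm.const_mul C).mono' (aestronglyMeasurable_gaussianKernel_mul_inner hY hV.1 x)
    (ae_of_all _ fun ω => hC _ _)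

/-- The gradient of the kernel is bounded, so differentiation under the expectation needs no moment
of `Y`. -/
theorem hasFDerivAt_smoothedDensity [IsProbabilityMeasure P] (hs : 0 < s) (hY : AEMeasurable Y P)
    (x : E) : HasFDerivAt (smoothedDensity P s Y)
      ((-s⁻¹) • innerSL ℝ (smoothedDisplacement P s Y x)) x := by
  obtain ⟨C, -, -, -, hC, -⟩ := exists_gaussianKernel_bound E hs
  have hint : ∀ x : E, Integrable (fun ω => (-s⁻¹) • innerSL ℝ
      (gaussianKernel s (x - Y ω) • (x - Y ω))) P := fun x =>
    ((innerSL ℝ).integrable_comp (integrable_gaussianKernel_smul_sub hs hY x)).smul (-s⁻¹)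
  have h := hasFDerivAt_integral_of_dominated_of_fderiv_le (μ := P) (𝕜 := ℝ) (s := univ) (x₀ := x)
    (F := fun x ω => gaussianKernel s (x - Y ω))
    (F' := fun x ω => (-s⁻¹) • innerSL ℝ (gaussianKernel s (x - Y ω) • (x - Y ω)))
    (bound := fun _ => s⁻¹ * C) univ_mem
    (Eventually.of_forall fun x => aestronglyMeasurable_gaussianKernel_sub hY x)
    (integrable_gaussianKernel_sub hs hY x) (hint x).1
    (ae_of_all _ fun ω x _ => by
      rw [norm_smul, innerSL_apply_norm, norm_neg, Real.norm_of_nonneg (inv_pos.2 hs).le]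
      exact mul_le_mul_of_nonneg_left (hC _) (inv_pos.2 hs).le)
    (integrable_const _)
    (ae_of_all _ fun ω x _ => by
      refine (hasFDerivAt_gaussianKernel_sub s (Y ω) x).congr_fderiv ?_
      rw [map_smul, smul_smul, neg_mul])
  refine h.congr_fderiv ?_
  rw [integral_smul, (innerSL ℝ).integral_comp_comm (integrable_gaussianKernel_smul_sub hs hY x)]
  rfl

theorem continuous_smoothedDensity [IsProbabilityMeasure P] (hs : 0 < s) (hY : AEMeasurable Y P) :
    Continuous (smoothedDensity P s Y) :=
  continuous_iff_continuousAt.2 fun x => (hasFDerivAt_smoothedDensity hs hY x).continuousAt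

theorem smoothedDensity_pos [IsProbabilityMeasure P] (hs : 0 < s) (hY : AEMeasurable Y P) (x : E) :
    0 < smoothedDensity P s Y x := by
  refine (integral_pos_iff_support_of_nonneg (fun ω => (gaussianKernel_pos hs _).le)
    (integrable_gaussianKernel_sub hs hY x)).2 ?_
  have : Function.support (fun ω => gaussianKernel s (x - Y ω)) = univ :=
    eq_univ_of_forall fun ω => (gaussianKernel_pos hs _).ne'
  simp [this]

theorem continuous_smoothedDisplacement [IsProbabilityMeasure P] (hs : 0 < s)
    (hY : AEMeasurable Y P) : Continuous (smoothedDisplacement P s Y) := by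
  obtain ⟨C, -, -, -, hC, -⟩ := exists_gaussianKernel_bound E hs
  refine continuous_of_dominated (bound := fun _ => C)
    (fun x => (integrable_gaussianKernel_smul_sub hs hY x).1) (fun x => ae_of_all _ fun ω => hC _)
    (integrable_const _) (ae_of_all _ fun ω => ?_)
  have := continuous_gaussianKernel (E := E) s
  fun_prop

theorem continuous_smoothedMomentum [IsProbabilityMeasure P] (hs : 0 < s)
    (hY : AEMeasurable Y P) (hV : Integrable V P) : Continuous (smoothedMomentum P s Y V) := by
  obtain ⟨C, -, -, hC, -, -⟩ := exists_gaussianKernel_bound E hs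
  refine continuous_of_dominated (bound := fun ω => C * ‖V ω‖)
    (fun x => (integrable_gaussianKernel_smul hs hY hV x).1) (fun x => ae_of_all _ fun ω => ?_)
    (hV.norm.const_mul _) (ae_of_all _ fun ω => ?_)
  · rw [norm_smul]
    exact mul_le_mul_of_nonneg_right (hC _) (norm_nonneg _)
  · have := continuous_gaussianKernel (E := E) s
    fun_prop

theorem continuous_smoothedWork [IsProbabilityMeasure P] (hs : 0 < s)
    (hY : AEMeasurable Y P) (hV : Integrable V P) : Continuous (smoothedWork P s Y V) := by
  obtain ⟨C, -, -, -, -, hC⟩ := exists_gaussianKernel_bound E hs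
  refine continuous_of_dominated (bound := fun ω => C * ‖V ω‖)
    (fun x => (integrable_gaussianKernel_mul_inner hs hY hV x).1)
    (fun x => ae_of_all _ fun ω => hC _ _) (hV.norm.const_mul _) (ae_of_all _ fun ω => ?_)
  have := continuous_gaussianKernel (E := E) s
  fun_prop

theorem integral_sub_sub_add {a b c d : Ω → ℝ} (ha : Integrable a P) (hb : Integrable b P)
    (hc : Integrable c P) (hd : Integrable d P) :
    ∫ ω, (a ω - b ω - c ω + d ω) ∂P =
      ∫ ω, a ω ∂P - ∫ ω, b ω ∂P - ∫ ω, c ω ∂P + ∫ ω, d ω ∂P := by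
  have hab : Integrable (fun ω => a ω - b ω) P := ha.sub hb
  have habc : Integrable (fun ω => a ω - b ω - c ω) P := hab.sub hc
  rw [integral_add habc hd, integral_sub hab hc, integral_sub ha hb]

/-- The averaged velocity `smoothedMomentum / smoothedDensity` has nonpositive divergence if `V`
is monotonically decreasing along `Y`. -/
theorem inner_smoothedDisplacement_smoothedMomentum_le [IsProbabilityMeasure P] (hs : 0 < s)
    (hY : AEMeasurable Y P) (hV : Integrable V P)
    (hYV : ∀ ω ω', ⟪Y ω - Y ω', V ω - V ω'⟫_ℝ ≤ 0) (x : E) :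
    ⟪smoothedDisplacement P s Y x, smoothedMomentum P s Y V x⟫_ℝ ≤
      smoothedDensity P s Y x * smoothedWork P s Y V x := by
  set k : Ω → ℝ := fun ω => gaussianKernel s (x - Y ω) with hk
  set f := smoothedDensity P s Y x with hf
  set p := smoothedDisplacement P s Y x with hp
  set m := smoothedMomentum P s Y V x with hm
  set A := smoothedWork P s Y V x with hA
  have if0 := integrable_gaussianKernel_sub hs hY x
  have ip := integrable_gaussianKernel_smul_sub hs hY x
  have im := integrable_gaussianKernel_smul hs hY hV x
  have iA := integrable_gaussianKernel_mul_inner hs hY hV x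
  -- Symmetrization over an independent copy `ω'`: the diagonal terms produce `f * A` twice, the
  -- cross terms `⟪p, m⟫` twice.
  have hinner : ∀ ω, ∫ ω', k ω' * ⟪(x - Y ω) - (x - Y ω'), V ω - V ω'⟫_ℝ ∂P =
      f * ⟪x - Y ω, V ω⟫_ℝ - ⟪x - Y ω, m⟫_ℝ - ⟪V ω, p⟫_ℝ + A := by
    intro ω
    have e : ∀ ω', k ω' * ⟪(x - Y ω) - (x - Y ω'), V ω - V ω'⟫_ℝ =
        k ω' * ⟪x - Y ω, V ω⟫_ℝ - ⟪x - Y ω, k ω' • V ω'⟫_ℝ - ⟪V ω, k ω' • (x - Y ω')⟫_ℝ +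
          k ω' * ⟪x - Y ω', V ω'⟫_ℝ := fun ω' => by
      rw [inner_sub_left, inner_sub_right, inner_sub_right, real_inner_smul_right,
        real_inner_smul_right, real_inner_comm (x - Y ω') (V ω)]
      ring
    simp_rw [e]
    rw [integral_sub_sub_add (if0.mul_const _) (im.const_inner _) (ip.const_inner _) iA,
      integral_mul_const, integral_inner im,
      integral_inner ip]
    rfl
  have houter : ∫ ω, k ω * ∫ ω', k ω' * ⟪(x - Y ω) - (x - Y ω'), V ω - V ω'⟫_ℝ ∂P ∂P =
      2 * (f * A - ⟪p, m⟫_ℝ) := by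
    have e : ∀ ω, k ω * ∫ ω', k ω' * ⟪(x - Y ω) - (x - Y ω'), V ω - V ω'⟫_ℝ ∂P =
        f * (k ω * ⟪x - Y ω, V ω⟫_ℝ) - ⟪m, k ω • (x - Y ω)⟫_ℝ - ⟪p, k ω • V ω⟫_ℝ + k ω * A :=
      fun ω => by
        rw [hinner, real_inner_smul_right, real_inner_smul_right, real_inner_comm m,
          real_inner_comm p]
        ring
    simp_rw [e]
    rw [integral_sub_sub_add (iA.const_mul _) (ip.const_inner _) (im.const_inner _)
        (if0.mul_const _), integral_const_mul, integral_mul_const,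
      integral_inner im, integral_inner ip]
    change f * A - ⟪m, p⟫_ℝ - ⟪p, m⟫_ℝ + f * A = _
    rw [real_inner_comm]
    ring
  have hnonneg : 0 ≤ ∫ ω, k ω * ∫ ω', k ω' * ⟪(x - Y ω) - (x - Y ω'), V ω - V ω'⟫_ℝ ∂P ∂P := by
    refine integral_nonneg fun ω => mul_nonneg (gaussianKernel_pos hs _).le
      (integral_nonneg fun ω' => mul_nonneg (gaussianKernel_pos hs _).le ?_)
    have h := hYV ω ω'
    have e : (x - Y ω) - (x - Y ω') = -(Y ω - Y ω') := by abel
    rw [e, inner_neg_left]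
    linarith
  rw [houter] at hnonneg
  linarith

theorem integral_integral_mul_swap_of_bound [IsFiniteMeasure P] {w : E → ℝ} {G : E → Ω → ℝ}
    {B : Ω → ℝ} (hw : Integrable w) (hB : Integrable B P)
    (hG : AEStronglyMeasurable (Function.uncurry G) ((volume : Measure E).prod P))
    (hGB : ∀ x ω, |G x ω| ≤ B ω) :
    ∫ x, w x * ∫ ω, G x ω ∂P = ∫ ω, (∫ x, w x * G x ω) ∂P := by
  simp_rw [← integral_const_mul]
  refine integral_integral_swap ((hw.norm.mul_prod hB).mono' (hw.1.comp_fst.mul hG) ?_)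
  refine ae_of_all _ fun z => ?_
  simp only [Function.uncurry, norm_mul]
  exact mul_le_mul_of_nonneg_left (hGB _ _) (norm_nonneg _)

theorem aestronglyMeasurable_gaussianKernel_sub_prod [SFinite P] (hY : AEMeasurable Y P) :
    AEStronglyMeasurable (fun z : E × Ω => gaussianKernel s (z.1 - Y z.2))
      ((volume : Measure E).prod P) :=
  ((continuous_gaussianKernel s).measurable.comp_aemeasurable
    (measurable_fst.aemeasurable.sub hY.comp_snd)).aestronglyMeasurable

/-- Integration by parts: `smoothedWork` is a divergence. -/
theorem integral_mul_smoothedWork [IsProbabilityMeasure P] (hs : 0 < s) (hY : AEMeasurable Y P)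
    (hV : Integrable V P) {q q' : ℝ → ℝ} (hq : ∀ u, HasDerivAt q (q' u) u) (hq' : Continuous q')
    (hqs : HasCompactSupport fun x => q (smoothedDensity P s Y x))
    (hqs' : HasCompactSupport fun x => q' (smoothedDensity P s Y x)) :
    ∫ x, q (smoothedDensity P s Y x) * smoothedWork P s Y V x =
      -∫ x, q' (smoothedDensity P s Y x) *
        ⟪smoothedDisplacement P s Y x, smoothedMomentum P s Y V x⟫_ℝ := by
  obtain ⟨C, hC0, -, hC1, hC2, hC3⟩ := exists_gaussianKernel_bound E hs
  have hk := continuous_gaussianKernel (E := E) s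
  have hf := continuous_smoothedDensity hs hY
  have hp := continuous_smoothedDisplacement hs hY
  have hqc : Continuous q := continuous_iff_continuousAt.2 fun u => (hq u).continuousAt
  have hpC : ∀ x, ‖smoothedDisplacement P s Y x‖ ≤ C := fun x => by
    have := norm_integral_le_of_norm_le_const (μ := P) (f := fun ω => gaussianKernel s (x - Y ω) •
      (x - Y ω)) (C := C) (ae_of_all _ fun ω => hC2 _)
    simpa [smoothedDisplacement] using this
  -- With both sides written as expectations, Fubini freezes `ω`, and `V ω` becomes a constant
  -- vector.
  have hm : ∀ x, ⟪smoothedDisplacement P s Y x, smoothedMomentum P s Y V x⟫_ℝ =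
      ∫ ω, gaussianKernel s (x - Y ω) * ⟪smoothedDisplacement P s Y x, V ω⟫_ℝ ∂P := fun x => by
    rw [smoothedMomentum, ← integral_inner (integrable_gaussianKernel_smul hs hY hV x)]
    simp_rw [real_inner_smul_right]
  have hkm := aestronglyMeasurable_gaussianKernel_sub_prod (s := s) hY
  simp_rw [hm]
  unfold smoothedWork
  have hG1 : AEStronglyMeasurable (Function.uncurry fun x ω => gaussianKernel s (x - Y ω) *
      ⟪x - Y ω, V ω⟫_ℝ) ((volume : Measure E).prod P) :=
    hkm.mul ((measurable_fst.aemeasurable.sub hY.comp_snd).aestronglyMeasurable.inner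
      hV.1.comp_snd)
  have hG2 : AEStronglyMeasurable (Function.uncurry fun x ω => gaussianKernel s (x - Y ω) *
      ⟪smoothedDisplacement P s Y x, V ω⟫_ℝ) ((volume : Measure E).prod P) :=
    hkm.mul ((hp.aestronglyMeasurable.comp_fst).inner hV.1.comp_snd)
  rw [integral_integral_mul_swap_of_bound
      (w := fun x => q (smoothedDensity P s Y x)) ((hqc.comp hf).integrable_of_hasCompactSupport hqs)
      (hV.norm.const_mul C) hG1 (fun x ω => hC3 _ _),
    integral_integral_mul_swap_of_bound
      (w := fun x => q' (smoothedDensity P s Y x)) ((hq'.comp hf).integrable_of_hasCompactSupport hqs')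
      (hV.norm.const_mul (C * C)) hG2 (fun x ω => ?_), ← integral_neg]
  swap
  · rw [abs_mul, mul_assoc]
    exact mul_le_mul (hC1 _) ((abs_real_inner_le_norm _ _).trans
      (mul_le_mul_of_nonneg_right (hpC x) (norm_nonneg _))) (abs_nonneg _) hC0
  -- What remains is integration by parts of `q(f)` against the kernel in the direction `V ω`; both
  -- gradients carry the factor `-s⁻¹`, which cancels.
  refine integral_congr_ae (ae_of_all _ fun ω => ?_)
  have hdk : ∀ x, HasFDerivAt (fun x => gaussianKernel s (x - Y ω))
      (-(s⁻¹ * gaussianKernel s (x - Y ω)) • innerSL ℝ (x - Y ω)) x :=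
    hasFDerivAt_gaussianKernel_sub s (Y ω)
  have hdq : ∀ x, HasFDerivAt (fun x => q (smoothedDensity P s Y x))
      (q' (smoothedDensity P s Y x) • (-s⁻¹) • innerSL ℝ (smoothedDisplacement P s Y x)) x :=
    fun x => (hq _).comp_hasFDerivAt x (hasFDerivAt_smoothedDensity hs hY x)
  have hk' : Continuous fun x => gaussianKernel s (x - Y ω) := by fun_prop
  have hqf : Continuous fun x => q (smoothedDensity P s Y x) := hqc.comp hf
  have hqf' : Continuous fun x => q' (smoothedDensity P s Y x) := hq'.comp hf
  have e1 : ∀ x, q (smoothedDensity P s Y x) *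
      fderiv ℝ (fun x => gaussianKernel s (x - Y ω)) x (V ω) =
      -s⁻¹ * (q (smoothedDensity P s Y x) *
        (gaussianKernel s (x - Y ω) * ⟪x - Y ω, V ω⟫_ℝ)) := fun x => by
    rw [(hdk x).fderiv, smul_apply, innerSL_apply_apply, smul_eq_mul]
    ring
  have e2 : ∀ x, fderiv ℝ (fun x => q (smoothedDensity P s Y x)) x (V ω) *
      gaussianKernel s (x - Y ω) =
      -s⁻¹ * (q' (smoothedDensity P s Y x) *
        (gaussianKernel s (x - Y ω) * ⟪smoothedDisplacement P s Y x, V ω⟫_ℝ)) := fun x => by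
    rw [(hdq x).fderiv, smul_apply, smul_apply, innerSL_apply_apply, smul_eq_mul, smul_eq_mul]
    ring
  have ibp := integral_mul_fderiv_eq_neg_fderiv_mul_of_integrable (μ := (volume : Measure E))
    (𝕜 := ℝ) (f := fun x => q (smoothedDensity P s Y x)) (g := fun x => gaussianKernel s (x - Y ω))
    (v := V ω) ?_ ?_ ?_ (fun x _ => (hdq x).differentiableAt) (fun x _ => (hdk x).differentiableAt)
  · simp_rw [e1, e2, integral_const_mul] at ibp
    have : s⁻¹ ≠ 0 := (inv_pos.2 hs).ne'
    refine mul_left_cancel₀ this ?_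
    linarith
  · simp_rw [e2]
    refine Continuous.integrable_of_hasCompactSupport (by fun_prop) (hqs'.mul_right.mul_left)
  · simp_rw [e1]
    refine Continuous.integrable_of_hasCompactSupport (by fun_prop) (hqs.mul_right.mul_left)
  · exact (hqf.mul hk').integrable_of_hasCompactSupport hqs.mul_right

end Smoothing

theorem hasCompactSupport_comp_of_norm_gt {E : Type*} [NormedAddCommGroup E] [ProperSpace E]
    {q : ℝ → ℝ} {f : E → ℝ} {a R : ℝ}
    (hq : ∀ u ≤ a, q u = 0) (hf : ∀ x, R < ‖x‖ → f x ≤ a) :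
    HasCompactSupport fun x => q (f x) := by
  refine .of_support_subset_isCompact (isCompact_closedBall 0 R) fun x hx => ?_
  by_contra hxR
  exact hx (hq _ (hf x (by simpa using hxR)))

/-! ### Contracting flows: monotonicity for smooth test functions. -/

section Flow

variable {E : Type*} [NormedAddCommGroup E] [InnerProductSpace ℝ E] [FiniteDimensional ℝ E]
  [MeasurableSpace E] [BorelSpace E] {Ω : Type*} [MeasurableSpace Ω]

/-- A family of random vectors `Y t`, `t ∈ [0, 1]`, with velocities `V t` dominated by an
integrable random variable `S`, moving in such a way that no two realizations move apart. -/
structure IsContractingFlow (P : Measure Ω) (Y V : ℝ → Ω → E) (S : Ω → ℝ) : Prop where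
  aemeasurable : ∀ t ∈ Icc (0 : ℝ) 1, AEMeasurable (Y t) P
  integrable_velocity : ∀ t ∈ Icc (0 : ℝ) 1, Integrable (V t) P
  hasDerivWithinAt : ∀ ω, ∀ t ∈ Icc (0 : ℝ) 1,
    HasDerivWithinAt (fun t => Y t ω) (V t ω) (Icc 0 1) t
  norm_velocity_le : ∀ ω, ∀ t ∈ Icc (0 : ℝ) 1, ‖V t ω‖ ≤ S ω
  integrable_speed : Integrable S P
  integrable_start : Integrable (Y 0) P
  inner_nonpos : ∀ t ∈ Icc (0 : ℝ) 1, ∀ ω ω', ⟪Y t ω - Y t ω', V t ω - V t ω'⟫_ℝ ≤ 0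

namespace IsContractingFlow

variable {P : Measure Ω} {Y V : ℝ → Ω → E} {S : Ω → ℝ} {s t : ℝ}

omit [FiniteDimensional ℝ E] [BorelSpace E] in
theorem norm_le (h : IsContractingFlow P Y V S) (ht : t ∈ Icc (0 : ℝ) 1) (ω : Ω) :
    ‖Y t ω‖ ≤ ‖Y 0 ω‖ + S ω := by
  have h0 : (0 : ℝ) ∈ Icc (0 : ℝ) 1 := by simp
  have hb := Convex.norm_image_sub_le_of_norm_hasDerivWithin_le (h.hasDerivWithinAt ω)
    (h.norm_velocity_le ω) (convex_Icc 0 1) h0 ht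
  have hS : 0 ≤ S ω := (norm_nonneg _).trans (h.norm_velocity_le ω 0 h0)
  have h1 : S ω * ‖t - 0‖ ≤ S ω := by
    refine mul_le_of_le_one_right hS ?_
    rw [sub_zero, Real.norm_of_nonneg ht.1]
    exact ht.2
  have h2 := norm_sub_norm_le (Y t ω) (Y 0 ω)
  linarith

/-- The continuity equation. The trajectories have two-sided derivatives only inside the interval;
the endpoints are reached by continuity. -/
theorem hasDerivAt_smoothedDensity [IsProbabilityMeasure P] (h : IsContractingFlow P Y V S)
    (hs : 0 < s) (ht : t ∈ Ioo (0 : ℝ) 1) (x : E) :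
    HasDerivAt (fun t => smoothedDensity P s (Y t) x) (s⁻¹ * smoothedWork P s (Y t) (V t) x) t := by
  obtain ⟨C, hC0, -, -, -, hC⟩ := exists_gaussianKernel_bound E hs
  have hI : Ioo (0 : ℝ) 1 ⊆ Icc 0 1 := Ioo_subset_Icc_self
  have hnhds : Ioo (0 : ℝ) 1 ∈ 𝓝 t := isOpen_Ioo.mem_nhds ht
  have hd := (hasDerivAt_integral_of_dominated_loc_of_deriv_le (μ := P) (𝕜 := ℝ) (x₀ := t)
    (F := fun t ω => gaussianKernel s (x - Y t ω))
    (F' := fun t ω => s⁻¹ * (gaussianKernel s (x - Y t ω) * ⟪x - Y t ω, V t ω⟫_ℝ))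
    (bound := fun ω => s⁻¹ * (C * S ω)) hnhds
    (eventually_of_mem hnhds fun t ht =>
      aestronglyMeasurable_gaussianKernel_sub (h.aemeasurable t (hI ht)) x)
    (integrable_gaussianKernel_sub hs (h.aemeasurable t (hI ht)) x)
    ((aestronglyMeasurable_gaussianKernel_mul_inner (h.aemeasurable t (hI ht))
      (h.integrable_velocity t (hI ht)).1 x).const_mul _)
    (ae_of_all _ fun ω t ht => by
      rw [norm_mul, Real.norm_of_nonneg (inv_pos.2 hs).le]
      exact mul_le_mul_of_nonneg_left ((hC _ _).trans
        (mul_le_mul_of_nonneg_left (h.norm_velocity_le ω t (hI ht)) hC0)) (inv_pos.2 hs).le)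
    ((h.integrable_speed.const_mul _).const_mul _)
    (ae_of_all _ fun ω t ht => by
      have hY : HasDerivAt (fun t => x - Y t ω) (-V t ω) t :=
        ((h.hasDerivWithinAt ω t (hI ht)).hasDerivAt (Icc_mem_nhds ht.1 ht.2)).const_sub x
      refine ((hasFDerivAt_gaussianKernel s (x - Y t ω)).comp_hasDerivAt t hY).congr_deriv ?_
      rw [smul_apply, innerSL_apply_apply, inner_neg_right, smul_eq_mul]
      ring)).2
  refine hd.congr_deriv ?_
  rw [integral_const_mul, smoothedWork]

theorem continuousOn_smoothedDensity [IsProbabilityMeasure P] (h : IsContractingFlow P Y V S)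
    (hs : 0 < s) (x : E) :
    ContinuousOn (fun t => smoothedDensity P s (Y t) x) (Icc 0 1) := by
  obtain ⟨C, -, -, hC, -⟩ := exists_gaussianKernel_bound E hs
  exact continuousOn_of_dominated (bound := fun _ => C)
    (fun t ht => aestronglyMeasurable_gaussianKernel_sub (h.aemeasurable t ht) x)
    (fun t _ => ae_of_all _ fun ω => hC _) (integrable_const _)
    (ae_of_all _ fun ω => (continuous_gaussianKernel s).comp_continuousOn
      (continuousOn_const.sub fun t ht => (h.hasDerivWithinAt ω t ht).continuousWithinAt))

/-- Since `1 + ‖x‖ ≤ (1 + ‖x - Y t‖)(1 + ‖Y t‖)` and `‖Y t‖ ≤ ‖Y 0‖ + S`, the two integrability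
assumptions give decay uniform in `t`. -/
theorem exists_smoothedDensity_le [IsProbabilityMeasure P] (h : IsContractingFlow P Y V S)
    (hs : 0 < s) :
    ∃ D : ℝ, ∀ t ∈ Icc (0 : ℝ) 1, ∀ x, smoothedDensity P s (Y t) x ≤ D / (1 + ‖x‖) := by
  obtain ⟨C, hC0, hC, -⟩ := exists_gaussianKernel_bound E hs
  refine ⟨∫ ω, C * (1 + (‖Y 0 ω‖ + S ω)) ∂P, fun t ht x => ?_⟩
  rw [← integral_div]
  refine integral_mono (integrable_gaussianKernel_sub hs (h.aemeasurable t ht) x)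
    ((((integrable_const 1).add (h.integrable_start.norm.add h.integrable_speed)).const_mul
      C).div_const _) fun ω => ?_
  have hx : 0 < 1 + ‖x‖ := by positivity
  change gaussianKernel s (x - Y t ω) ≤ _
  rw [le_div_iff₀ hx]
  have h1 := h.norm_le ht ω
  have h2 : ‖x‖ ≤ ‖x - Y t ω‖ + ‖Y t ω‖ := norm_le_norm_sub_add _ _
  have h3 : 1 + ‖x‖ ≤ (1 + ‖x - Y t ω‖) * (1 + (‖Y 0 ω‖ + S ω)) := by
    nlinarith [norm_nonneg (x - Y t ω), norm_nonneg (Y t ω)]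
  have hB : 0 ≤ 1 + (‖Y 0 ω‖ + S ω) := by linarith [norm_nonneg (Y t ω)]
  calc gaussianKernel s (x - Y t ω) * (1 + ‖x‖)
      ≤ gaussianKernel s (x - Y t ω) * ((1 + ‖x - Y t ω‖) * (1 + (‖Y 0 ω‖ + S ω))) :=
        mul_le_mul_of_nonneg_left h3 (gaussianKernel_pos hs _).le
    _ = ((1 + ‖x - Y t ω‖) * gaussianKernel s (x - Y t ω)) * (1 + (‖Y 0 ω‖ + S ω)) := by ring
    _ ≤ C * (1 + (‖Y 0 ω‖ + S ω)) := mul_le_mul_of_nonneg_right (hC _) hB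

/-- One ball contains the sets where the density exceeds `a`, for all times at once. This makes
`q(f)` compactly supported and provides the dominating functions in time. -/
theorem exists_smoothedDensity_le_of_norm_ge [IsProbabilityMeasure P]
    (h : IsContractingFlow P Y V S) (hs : 0 < s) {a : ℝ} (ha : 0 < a) :
    ∃ R : ℝ, ∀ t ∈ Icc (0 : ℝ) 1, ∀ x, R < ‖x‖ → smoothedDensity P s (Y t) x ≤ a := by
  obtain ⟨D, hD⟩ := h.exists_smoothedDensity_le hs
  refine ⟨D / a, fun t ht x hx => (hD t ht x).trans ?_⟩
  rw [div_lt_iff₀ ha] at hx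
  rw [div_le_iff₀ (by positivity)]
  nlinarith [norm_nonneg x]

theorem abs_smoothedWork_le (h : IsContractingFlow P Y V S) {C : ℝ} (hC0 : 0 ≤ C)
    (hC : ∀ x v : E, |gaussianKernel s x * ⟪x, v⟫_ℝ| ≤ C * ‖v‖) (ht : t ∈ Icc (0 : ℝ) 1) (x : E) :
    |smoothedWork P s (Y t) (V t) x| ≤ C * ∫ ω, S ω ∂P := by
  rw [← integral_const_mul]
  exact norm_integral_le_of_norm_le (f := fun ω => gaussianKernel s (x - Y t ω) *
    ⟪x - Y t ω, V t ω⟫_ℝ) (h.integrable_speed.const_mul C) (ae_of_all _ fun ω =>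
    (hC _ _).trans (mul_le_mul_of_nonneg_left (h.norm_velocity_le ω t ht) hC0))

/-- Along a contracting flow, the smoothed density evaluated at a random point distributed
according to it is stochastically nondecreasing: version for smooth test functions. -/
theorem monotoneOn_integral_mul_of_hasDerivAt [IsProbabilityMeasure P]
    (h : IsContractingFlow P Y V S) (hs : 0 < s) {q q' : ℝ → ℝ} (hq : ∀ u, HasDerivAt q (q' u) u)
    (hq' : Continuous q') (hq0 : ∀ u, 0 ≤ q' u) {a : ℝ} (ha : 0 < a) (hqa : ∀ u ≤ a, q u = 0)
    (hqa' : ∀ u ≤ a, q' u = 0) :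
    MonotoneOn (fun t => ∫ x, smoothedDensity P s (Y t) x * q (smoothedDensity P s (Y t) x))
      (Icc 0 1) := by
  obtain ⟨C, hC0, -, hC1, -, hC3⟩ := exists_gaussianKernel_bound E hs
  obtain ⟨R, hR⟩ := h.exists_smoothedDensity_le_of_norm_ge hs ha
  set f : ℝ → E → ℝ := fun t => smoothedDensity P s (Y t) with hf
  have hqc : Continuous q := continuous_iff_continuousAt.2 fun u => (hq u).continuousAt
  have hfc : ∀ t ∈ Icc (0 : ℝ) 1, Continuous (f t) := fun t ht =>
    continuous_smoothedDensity hs (h.aemeasurable t ht)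
  have hfC : ∀ t ∈ Icc (0 : ℝ) 1, ∀ x, f t x ∈ Icc 0 C := fun t ht x => by
    refine ⟨(smoothedDensity_pos hs (h.aemeasurable t ht) x).le, (le_abs_self _).trans ?_⟩
    have := norm_integral_le_of_norm_le_const (μ := P)
      (f := fun ω => gaussianKernel s (x - Y t ω)) (C := C) (ae_of_all _ fun ω => hC1 _)
    simpa [hf, smoothedDensity] using this
  obtain ⟨L, hL⟩ := isCompact_Icc.exists_bound_of_continuousOn (s := Icc 0 C)
    (f := fun u => u * q u) (by fun_prop)
  obtain ⟨L', hL'⟩ := isCompact_Icc.exists_bound_of_continuousOn (s := Icc 0 C)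
    (f := fun u => q u + u * q' u) (by fun_prop)
  have hball : Integrable (indicator (Metric.closedBall (0 : E) R) fun _ => L) :=
    (integrable_indicator_iff measurableSet_closedBall).2
      (integrableOn_const measure_closedBall_lt_top.ne)
  have hball' : Integrable (indicator (Metric.closedBall (0 : E) R)
      fun _ => L' * (s⁻¹ * (C * ∫ ω, S ω ∂P))) :=
    (integrable_indicator_iff measurableSet_closedBall).2
      (integrableOn_const measure_closedBall_lt_top.ne)
  have hbound : ∀ t ∈ Icc (0 : ℝ) 1, ∀ x,
      ‖f t x * q (f t x)‖ ≤ indicator (Metric.closedBall (0 : E) R) (fun _ => L) x := by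
    intro t ht x
    by_cases hx : x ∈ Metric.closedBall (0 : E) R
    · rw [indicator_of_mem hx]
      exact hL _ (hfC t ht x)
    · rw [indicator_of_notMem hx, hqa _ (hR t ht x (by simpa using hx))]
      simp
  have hmeas : ∀ t ∈ Icc (0 : ℝ) 1, Continuous fun x => f t x * q (f t x) := fun t ht =>
    (hfc t ht).mul (hqc.comp (hfc t ht))
  have hI : Ioo (0 : ℝ) 1 ⊆ Icc 0 1 := Ioo_subset_Icc_self
  have hderiv : ∀ t ∈ Ioo (0 : ℝ) 1, HasDerivAt (fun t => ∫ x, f t x * q (f t x))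
      (∫ x, (q (f t x) + f t x * q' (f t x)) * (s⁻¹ * smoothedWork P s (Y t) (V t) x)) t := by
    intro t ht
    have hnhds : Ioo (0 : ℝ) 1 ∈ 𝓝 t := isOpen_Ioo.mem_nhds ht
    refine (hasDerivAt_integral_of_dominated_loc_of_deriv_le (𝕜 := ℝ) (x₀ := t)
      (F := fun t x => f t x * q (f t x))
      (F' := fun t x => (q (f t x) + f t x * q' (f t x)) *
        (s⁻¹ * smoothedWork P s (Y t) (V t) x)) hnhds
      (eventually_of_mem hnhds fun t ht => (hmeas t (hI ht)).aestronglyMeasurable)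
      (hball.mono' (hmeas t (hI ht)).aestronglyMeasurable (ae_of_all _ (hbound t (hI ht))))
      ?_ (ae_of_all _ fun x t ht => ?_) hball' (ae_of_all _ fun x t ht => ?_)).2
    · have := hfc t (hI ht)
      have := continuous_smoothedWork hs (h.aemeasurable t (hI ht))
        (h.integrable_velocity t (hI ht))
      exact Continuous.aestronglyMeasurable (by fun_prop)
    · by_cases hx : x ∈ Metric.closedBall (0 : E) R
      · rw [indicator_of_mem hx, norm_mul, norm_mul, Real.norm_of_nonneg (inv_pos.2 hs).le]
        have h1 := hL' _ (hfC t (hI ht) x)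
        have h2 := h.abs_smoothedWork_le hC0 hC3 (hI ht) x
        exact mul_le_mul h1 (mul_le_mul_of_nonneg_left h2 (inv_pos.2 hs).le) (by positivity)
          ((norm_nonneg _).trans h1)
      · have hx' := hR t (hI ht) x (by simpa using hx)
        rw [indicator_of_notMem hx, hqa _ hx', hqa' _ hx']
        simp
    · have h1 : HasDerivAt (fun t => f t x) _ t := h.hasDerivAt_smoothedDensity hs ht x
      refine (h1.mul ((hq (f t x)).comp t h1)).congr_deriv ?_
      simp only [Function.comp_apply]
      ring
  refine monotoneOn_of_deriv_nonneg (convex_Icc 0 1) ?_ ?_ ?_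
  · exact continuousOn_of_dominated (fun t ht => (hmeas t ht).aestronglyMeasurable)
      (fun t ht => ae_of_all _ (hbound t ht)) hball
      (ae_of_all _ fun x => (h.continuousOn_smoothedDensity hs x).mul
        (hqc.comp_continuousOn (h.continuousOn_smoothedDensity hs x)))
  · rw [interior_Icc]
    exact fun t ht => (hderiv t ht).differentiableAt.differentiableWithinAt
  · rw [interior_Icc]
    intro t ht
    rw [(hderiv t ht).deriv]
    have hY := h.aemeasurable t (hI ht)
    have hV := h.integrable_velocity t (hI ht)
    have hsq := hasCompactSupport_comp_of_norm_gt hqa (hR t (hI ht))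
    have hsq' := hasCompactSupport_comp_of_norm_gt hqa' (hR t (hI ht))
    have ibp := integral_mul_smoothedWork hs hY hV hq hq' hsq hsq'
    have cf := hfc t (hI ht)
    have cW := continuous_smoothedWork hs hY hV
    have cp := continuous_smoothedDisplacement hs hY
    have cm := continuous_smoothedMomentum hs hY hV
    have i1 : Integrable fun x => q (f t x) * smoothedWork P s (Y t) (V t) x :=
      Continuous.integrable_of_hasCompactSupport (by fun_prop) hsq.mul_right
    have i2 : Integrable fun x => q' (f t x) * (f t x * smoothedWork P s (Y t) (V t) x) :=
      Continuous.integrable_of_hasCompactSupport (by fun_prop) hsq'.mul_right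
    have i3 : Integrable fun x => q' (f t x) *
        ⟪smoothedDisplacement P s (Y t) x, smoothedMomentum P s (Y t) (V t) x⟫_ℝ :=
      Continuous.integrable_of_hasCompactSupport (by fun_prop) hsq'.mul_right
    have e : ∀ x, (q (f t x) + f t x * q' (f t x)) * (s⁻¹ * smoothedWork P s (Y t) (V t) x) =
        s⁻¹ * (q (f t x) * smoothedWork P s (Y t) (V t) x +
          q' (f t x) * (f t x * smoothedWork P s (Y t) (V t) x)) := fun x => by ring
    simp_rw [e]
    -- After integration by parts the integrand is `q'(f) (f W - ⟪p, m⟫)`, a product of nonnegative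
    -- factors.
    rw [integral_const_mul, integral_add i1 i2, ibp, neg_add_eq_sub, ← integral_sub i2 i3]
    refine mul_nonneg (inv_pos.2 hs).le (integral_nonneg fun x => ?_)
    have hkey := inner_smoothedDisplacement_smoothedMomentum_le hs hY hV
      (h.inner_nonpos t (hI ht)) x
    simp only [Pi.zero_apply, ← mul_sub]
    exact mul_nonneg (hq0 _) (sub_nonneg.2 hkey)

end IsContractingFlow

end Flow

/-! ### Half-lines, extended integrals and slopes of convex functions. -/

/-- The infimum, and whether it is attained, determine `U`. Infimum `0` stands apart because ramps
approximating that indicator cannot vanish near `0`. -/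
theorem upperSet_Ioi_zero_cases {U : Set ℝ} (hU0 : U ⊆ Ioi 0)
    (hU : ∀ u ∈ U, ∀ v, u ≤ v → v ∈ U) :
    U = ∅ ∨ U = Ioi 0 ∨ ∃ b > 0, U = Ioi b ∨ U = Ici b := by
  rcases U.eq_empty_or_nonempty with hne | hne
  · exact .inl hne
  have hbdd : BddBelow U := ⟨0, fun u hu => (hU0 hu).le⟩
  have hlt : Ioi (sInf U) ⊆ U := fun v hv => by
    obtain ⟨u, hu, huv⟩ := exists_lt_of_csInf_lt hne hv
    exact hU u hu v huv.le
  have hle : U ⊆ Ici (sInf U) := fun u hu => csInf_le hbdd hu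
  have hb : 0 ≤ sInf U := le_csInf hne fun u hu => (hU0 hu).le
  rcases hb.eq_or_lt with hb | hb
  · exact .inr (.inl (hU0.antisymm (hb ▸ hlt)))
  refine .inr (.inr ⟨sInf U, hb, ?_⟩)
  by_cases hmem : sInf U ∈ U
  · exact .inr (hle.antisymm fun u hu => hU _ hmem u hu)
  · exact .inl (Subset.antisymm (fun u hu =>
      mem_Ioi.2 (lt_of_le_of_ne (hle hu) fun e : sInf U = u => hmem (e.symm ▸ hu))) hlt)

/-- The offset fixes the limit at `u = b`: `0` for the open half-line, `1` for the closed one. It is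
written out so that both cases share one form. -/
theorem tendsto_smoothTransition_Ioi (b u : ℝ) :
    Tendsto (fun k : ℕ => Real.smoothTransition (k * (u - b) + 0)) atTop
      (𝓝 ((Ioi b).indicator 1 u)) := by
  simp only [add_zero]
  by_cases hu : b < u
  · rw [indicator_of_mem (mem_Ioi.2 hu)]
    refine tendsto_const_nhds.congr' ?_
    have h : Tendsto (fun k : ℕ => (k : ℝ) * (u - b)) atTop atTop :=
      tendsto_natCast_atTop_atTop.atTop_mul_const (sub_pos.2 hu)
    filter_upwards [h.eventually_ge_atTop 1] with k hk
    rw [Real.smoothTransition.one_of_one_le hk, Pi.one_apply]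
  · rw [indicator_of_notMem (by simpa using hu)]
    refine tendsto_const_nhds.congr fun k => ?_
    rw [Real.smoothTransition.zero_of_nonpos
      (mul_nonpos_of_nonneg_of_nonpos k.cast_nonneg (by linarith))]

theorem tendsto_smoothTransition_Ici (b u : ℝ) :
    Tendsto (fun k : ℕ => Real.smoothTransition (k * (u - b) + 1)) atTop
      (𝓝 ((Ici b).indicator 1 u)) := by
  by_cases hu : b ≤ u
  · rw [indicator_of_mem (mem_Ici.2 hu)]
    refine tendsto_const_nhds.congr fun k => ?_
    rw [Real.smoothTransition.one_of_one_le, Pi.one_apply]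
    have : 0 ≤ (k : ℝ) * (u - b) := mul_nonneg k.cast_nonneg (by linarith)
    linarith
  · rw [indicator_of_notMem (by simpa using hu)]
    refine tendsto_const_nhds.congr' ?_
    have h : Tendsto (fun k : ℕ => (k : ℝ) * (b - u)) atTop atTop :=
      tendsto_natCast_atTop_atTop.atTop_mul_const (by linarith)
    filter_upwards [h.eventually_ge_atTop 1] with k hk
    rw [Real.smoothTransition.zero_of_nonpos (by linarith)]

theorem extIntegral_sub {α : Type*} [MeasurableSpace α] {μ : Measure α} {w h : α → ℝ}
    (hw : Integrable w μ) (hh : AEMeasurable h μ) (hh0 : 0 ≤ h) :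
    extIntegral μ (fun x => w x - h x) =
      ((∫ x, w x ∂μ : ℝ) : EReal) - ((∫⁻ x, ENNReal.ofReal (h x) ∂μ : ℝ≥0∞) : EReal) := by
  have hwm := hw.aemeasurable
  have hWp : ∫⁻ x, ENNReal.ofReal (w x) ∂μ ≠ ∞ := hw.lintegral_lt_top.ne
  have hWn : ∫⁻ x, ENNReal.ofReal (-w x) ∂μ ≠ ∞ := hw.neg.lintegral_lt_top.ne
  have ha : ∫⁻ x, ENNReal.ofReal (w x - h x) ∂μ ≠ ∞ :=
    ne_top_of_le_ne_top hWp (lintegral_mono fun x =>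
      ENNReal.ofReal_le_ofReal (sub_le_self _ (hh0 x)))
  -- The identity `(w - h)⁺ + h + w⁻ = (w - h)⁻ + w⁺`, free of subtraction between integrals; only
  -- the integrals of `h` and `(w - h)⁻` can be infinite, and then both are.
  have hsum : ∫⁻ x, ENNReal.ofReal (w x - h x) ∂μ + ∫⁻ x, ENNReal.ofReal (h x) ∂μ +
      ∫⁻ x, ENNReal.ofReal (-w x) ∂μ =
      ∫⁻ x, ENNReal.ofReal (-(w x - h x)) ∂μ + ∫⁻ x, ENNReal.ofReal (w x) ∂μ := by
    rw [← lintegral_add_left' (by fun_prop), ← lintegral_add_left' (by fun_prop),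
      ← lintegral_add_left' (by fun_prop)]
    refine lintegral_congr fun x => ?_
    have h0 : 0 ≤ h x := hh0 x
    rcases le_total 0 (w x) with h1 | h1 <;> rcases le_total 0 (w x - h x) with h2 | h2
    · rw [ENNReal.ofReal_of_nonpos (p := -w x) (by linarith),
        ENNReal.ofReal_of_nonpos (p := -(w x - h x)) (by linarith),
        ← ENNReal.ofReal_add h2 h0]
      simp
    · rw [ENNReal.ofReal_of_nonpos (p := -w x) (by linarith),
        ENNReal.ofReal_of_nonpos (p := w x - h x) (by linarith),
        ← ENNReal.ofReal_add (by linarith) h1]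
      simp
    · have : w x = 0 := by linarith
      have : h x = 0 := by linarith
      simp [*]
    · rw [ENNReal.ofReal_of_nonpos (p := w x) (by linarith),
        ENNReal.ofReal_of_nonpos (p := w x - h x) (by linarith), zero_add,
        ← ENNReal.ofReal_add h0 (by linarith)]
      simp [sub_eq_add_neg]
  rw [extIntegral, integral_eq_lintegral_pos_part_sub_lintegral_neg_part hw]
  generalize ∫⁻ x, ENNReal.ofReal (w x - h x) ∂μ = a at *
  generalize ∫⁻ x, ENNReal.ofReal (h x) ∂μ = H at *
  generalize ∫⁻ x, ENNReal.ofReal (-w x) ∂μ = n at *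
  generalize ∫⁻ x, ENNReal.ofReal (w x) ∂μ = p at *
  generalize ∫⁻ x, ENNReal.ofReal (-(w x - h x)) ∂μ = b at *
  lift a to NNReal using ha
  lift n to NNReal using hWn
  lift p to NNReal using hWp
  by_cases hH : H = ∞
  · subst hH
    have hb : b = ∞ := by
      by_contra hb
      lift b to NNReal using hb
      simp [← ENNReal.coe_add] at hsum
    subst hb
    rw [EReal.coe_ennreal_top, EReal.sub_top, EReal.sub_top]
  · have hb : b ≠ ∞ := by
      rintro rfl
      lift H to NNReal using hH
      simp [← ENNReal.coe_add] at hsum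
    lift H to NNReal using hH
    lift b to NNReal using hb
    norm_cast at hsum
    have hsum' : (a : ℝ) + H + n = b + p := by exact_mod_cast hsum
    change ((a : ℝ) : EReal) - ((b : ℝ) : EReal) = (((p : ℝ) - n : ℝ) : EReal) - ((H : ℝ) : EReal)
    rw [← EReal.coe_sub, ← EReal.coe_sub]
    congr 1
    linarith

theorem extIntegral_congr_ae {α : Type*} [MeasurableSpace α] {μ : Measure α} {g h : α → ℝ}
    (hgh : g =ᵐ[μ] h) : extIntegral μ g = extIntegral μ h := by
  have h1 : ∫⁻ x, ENNReal.ofReal (g x) ∂μ = ∫⁻ x, ENNReal.ofReal (h x) ∂μ :=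
    lintegral_congr_ae (hgh.mono fun x hx => by simp only [hx])
  have h2 : ∫⁻ x, ENNReal.ofReal (-g x) ∂μ = ∫⁻ x, ENNReal.ofReal (-h x) ∂μ :=
    lintegral_congr_ae (hgh.mono fun x hx => by simp only [hx])
  rw [extIntegral, extIntegral, h1, h2]

/-- At `u` the graph lies below the chord from the origin to `(v, φ v)`. -/
theorem ConvexOn.div_le_div_of_map_zero {φ : ℝ → ℝ} (hφ : ConvexOn ℝ (Ici 0) φ) (h0 : φ 0 = 0)
    {u v : ℝ} (hu : 0 < u) (huv : u ≤ v) : φ u / u ≤ φ v / v := by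
  have hv : 0 < v := hu.trans_le huv
  have ha : 0 ≤ u / v := by positivity
  have h := hφ.2 (mem_Ici.2 hv.le) (mem_Ici.2 le_rfl) ha
    (sub_nonneg.2 ((div_le_one hv).2 huv)) (by ring)
  simp only [smul_eq_mul, mul_zero, add_zero, h0, div_mul_cancel₀ u hv.ne'] at h
  rw [div_le_div_iff₀ hu hv]
  calc φ u * v ≤ u / v * φ v * v := by gcongr
    _ = φ v * u := by field_simp

/-! ### Stochastic monotonicity of the density and convex integrands. -/

section Flow

variable {E : Type*} [NormedAddCommGroup E] [InnerProductSpace ℝ E] [FiniteDimensional ℝ E]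
  [MeasurableSpace E] [BorelSpace E] {Ω : Type*} [MeasurableSpace Ω] {P : Measure Ω} {s : ℝ}

theorem lintegral_smoothedDensity [IsProbabilityMeasure P] {Y : Ω → E} (hs : 0 < s)
    (hY : AEMeasurable Y P) : ∫⁻ x, ENNReal.ofReal (smoothedDensity P s Y x) = 1 := by
  have hprob : IsProbabilityMeasure (P.map Y) := Measure.isProbabilityMeasure_map hY
  simp_rw [ofReal_smoothedDensity hs hY]
  rw [lintegral_lintegral_swap (Measurable.aemeasurable ?_)]
  · have h1 : ∀ y : E, ∫⁻ x, ENNReal.ofReal (gaussianKernel s (x - y)) = 1 := fun y => by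
      rw [lintegral_sub_right_eq_self (fun x => ENNReal.ofReal (gaussianKernel s x)) y,
        ← ofReal_integral_eq_lintegral_ofReal (integrable_gaussianKernel hs)
          (ae_of_all _ fun x => (gaussianKernel_pos hs x).le), integral_gaussianKernel hs,
        ENNReal.ofReal_one]
    simp [h1]
  · exact ((continuous_gaussianKernel s).comp
      (continuous_fst.sub continuous_snd)).measurable.ennreal_ofReal

theorem integrable_smoothedDensity [IsProbabilityMeasure P] {Y : Ω → E} (hs : 0 < s)
    (hY : AEMeasurable Y P) : Integrable (smoothedDensity P s Y) := by
  refine ⟨(continuous_smoothedDensity hs hY).aestronglyMeasurable, ?_⟩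
  rw [hasFiniteIntegral_iff_ofReal (ae_of_all _ fun x => (smoothedDensity_pos hs hY x).le),
    lintegral_smoothedDensity hs hY]
  exact ENNReal.one_lt_top

theorem integral_smoothedDensity [IsProbabilityMeasure P] {Y : Ω → E} (hs : 0 < s)
    (hY : AEMeasurable Y P) : ∫ x, smoothedDensity P s Y x = 1 := by
  rw [integral_eq_lintegral_of_nonneg_ae
    (ae_of_all _ fun x => (smoothedDensity_pos hs hY x).le)
    (continuous_smoothedDensity hs hY).aestronglyMeasurable, lintegral_smoothedDensity hs hY,
    ENNReal.toReal_one]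

theorem exists_smoothedDensity_le_const [IsProbabilityMeasure P] (hs : 0 < s) :
    ∃ C > 0, ∀ (Y : Ω → E) (x : E), smoothedDensity P s Y x ≤ C := by
  obtain ⟨C, hC0, -, hC, -⟩ := exists_gaussianKernel_bound E hs
  -- The added `1` makes the bound strictly positive; it will serve as a denominator.
  refine ⟨C + 1, by positivity, fun Y x => ?_⟩
  have := norm_integral_le_of_norm_le_const (μ := P)
    (f := fun ω => gaussianKernel s (x - Y ω)) (C := C) (ae_of_all _ fun ω => hC _)
  rw [probReal_univ, mul_one] at this
  exact ((le_abs_self _).trans this).trans (by linarith)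

/-- Split `φ(f) = (φ M / M) f - f r(f)` with `r(f) ≥ 0`; the first term integrates to `φ M / M`. The
truncation by `min` is void here, as `f ≤ M`, but makes `r` nonnegative and antitone on all of `(0,
∞)`. -/
theorem extIntegral_comp_smoothedDensity [IsProbabilityMeasure P] {Y : Ω → E} (hs : 0 < s)
    (hY : AEMeasurable Y P) {φ : ℝ → ℝ} (hφ : ConvexOn ℝ (Ici 0) φ) (h0 : φ 0 = 0) {M : ℝ}
    (hM : ∀ x, smoothedDensity P s Y x ≤ M) :
    ∫⁻ x, ENNReal.ofReal (φ (smoothedDensity P s Y x)) < ∞ ∧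
    extIntegral volume (fun x => φ (smoothedDensity P s Y x)) = ((φ M / M : ℝ) : EReal) -
      ((∫⁻ x, ENNReal.ofReal (smoothedDensity P s Y x *
        (φ M / M - φ (min (smoothedDensity P s Y x) M) / min (smoothedDensity P s Y x) M)) :
          ℝ≥0∞) : EReal) := by
  have hf := continuous_smoothedDensity hs hY
  have hf0 := smoothedDensity_pos hs hY
  have hint := (integrable_smoothedDensity hs hY).const_mul (φ M / M)
  have hφc : ContinuousOn φ (Ioi 0) := by
    have := hφ.continuousOn_interior
    rwa [interior_Ici] at this
  have hφf : Continuous fun x => φ (smoothedDensity P s Y x) := hφc.comp_continuous hf hf0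
  have hslope : ∀ x, φ (smoothedDensity P s Y x) / smoothedDensity P s Y x ≤ φ M / M := fun x =>
    hφ.div_le_div_of_map_zero h0 (hf0 x) (hM x)
  have hle : ∀ x, φ (smoothedDensity P s Y x) ≤ φ M / M * smoothedDensity P s Y x := fun x =>
    (div_le_iff₀ (hf0 x)).1 (hslope x)
  refine ⟨(lintegral_mono fun x => ENNReal.ofReal_le_ofReal (hle x)).trans_lt
    hint.lintegral_lt_top, ?_⟩
  have hsub := extIntegral_sub (μ := (volume : Measure E)) (h := fun x =>
    φ M / M * smoothedDensity P s Y x - φ (smoothedDensity P s Y x)) hint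
    ((continuous_const.mul hf).sub hφf).aemeasurable (fun x => sub_nonneg.2 (hle x))
  simp only [sub_sub_cancel] at hsub
  rw [hsub, integral_const_mul, integral_smoothedDensity hs hY, mul_one]
  congr 3 with x
  have := (hf0 x).ne'
  rw [min_eq_left (hM x)]
  congr 1
  field_simp

namespace IsContractingFlow

variable {Y V : ℝ → Ω → E} {S : Ω → ℝ}

theorem monotoneOn_integral_mul_indicator [IsProbabilityMeasure P]
    (h : IsContractingFlow P Y V S) (hs : 0 < s) {b c : ℝ} (hb : 0 < b) (hc : c ≤ 1) {U : Set ℝ}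
    (hU : ∀ u, Tendsto (fun k : ℕ => Real.smoothTransition (k * (u - b) + c)) atTop
      (𝓝 (U.indicator 1 u))) :
    MonotoneOn (fun t => ∫ x, smoothedDensity P s (Y t) x *
      U.indicator 1 (smoothedDensity P s (Y t) x)) (Icc 0 1) := by
  have hlim : ∀ t ∈ Icc (0 : ℝ) 1, Tendsto (fun k : ℕ => ∫ x, smoothedDensity P s (Y t) x *
      Real.smoothTransition (k * (smoothedDensity P s (Y t) x - b) + c)) atTop
      (𝓝 (∫ x, smoothedDensity P s (Y t) x * U.indicator 1 (smoothedDensity P s (Y t) x))) := by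
    intro t ht
    have hY := h.aemeasurable t ht
    have hf := continuous_smoothedDensity hs hY
    have hst := Real.smoothTransition.continuous
    refine tendsto_integral_of_dominated_convergence (smoothedDensity P s (Y t))
      (fun k => Continuous.aestronglyMeasurable (by fun_prop)) (integrable_smoothedDensity hs hY)
      (fun k => ae_of_all _ fun x => ?_) (ae_of_all _ fun x => (hU _).const_mul _)
    have h0 := (smoothedDensity_pos hs hY x).le
    rw [Real.norm_of_nonneg (mul_nonneg h0 (Real.smoothTransition.nonneg _))]
    exact mul_le_of_le_one_right h0 (Real.smoothTransition.le_one _)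
  intro t ht t' ht' htt'
  refine le_of_tendsto_of_tendsto (hlim t ht) (hlim t' ht') ?_
  -- Once `k * (b / 2) ≥ 1`, the bound `c ≤ 1` makes the ramp vanish on `u ≤ b / 2`, the threshold
  -- required of test functions.
  filter_upwards [(tendsto_natCast_atTop_atTop.atTop_mul_const (half_pos hb)).eventually_ge_atTop
    (1 : ℝ)] with k hk
  have hsm : ContDiff ℝ 1 Real.smoothTransition := Real.smoothTransition.contDiff
  have hlin : ∀ u : ℝ, HasDerivAt (fun u : ℝ => (k : ℝ) * (u - b) + c) k u := fun u => by
    simpa using (((hasDerivAt_id u).sub_const b).const_mul (k : ℝ)).add_const c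
  have hzero : ∀ u ≤ b / 2, (k : ℝ) * (u - b) + c ≤ 0 := fun u hu => by
    nlinarith [k.cast_nonneg (α := ℝ)]
  have hd0 : ∀ v, 0 ≤ deriv Real.smoothTransition v := fun v =>
    Real.smoothTransition.monotone.deriv_nonneg
  refine h.monotoneOn_integral_mul_of_hasDerivAt hs
    (q := fun u => Real.smoothTransition (k * (u - b) + c))
    (q' := fun u => deriv Real.smoothTransition (k * (u - b) + c) * k)
    (fun u => ((hsm.differentiable one_ne_zero _).hasDerivAt).comp u (hlin u)) ?_
    (fun u => mul_nonneg (hd0 _) k.cast_nonneg) (half_pos hb)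
    (fun u hu => Real.smoothTransition.zero_of_nonpos (hzero u hu)) (fun u hu => ?_) ht ht' htt'
  · have := hsm.continuous_deriv le_rfl
    fun_prop
  · have hmin : IsLocalMin Real.smoothTransition ((k : ℝ) * (u - b) + c) :=
      Eventually.of_forall fun v => by
        rw [Real.smoothTransition.zero_of_nonpos (hzero u hu)]
        exact Real.smoothTransition.nonneg v
    rw [hmin.deriv_eq_zero, zero_mul]

/-- Along a contracting flow, the smoothed density evaluated at a random point distributed
according to it is stochastically nondecreasing. -/
theorem monotoneOn_withDensity_preimage [IsProbabilityMeasure P]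
    (h : IsContractingFlow P Y V S) (hs : 0 < s) {U : Set ℝ} (hU0 : U ⊆ Ioi 0)
    (hU : ∀ u ∈ U, ∀ v, u ≤ v → v ∈ U) :
    MonotoneOn (fun t => volume.withDensity (fun x => ENNReal.ofReal (smoothedDensity P s (Y t) x))
      (smoothedDensity P s (Y t) ⁻¹' U)) (Icc 0 1) := by
  have key : ∀ b > 0, ∀ c ≤ (1 : ℝ), ∀ U : Set ℝ, MeasurableSet U →
      (∀ u, Tendsto (fun k : ℕ => Real.smoothTransition (k * (u - b) + c)) atTop
        (𝓝 (U.indicator 1 u))) →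
      MonotoneOn (fun t => volume.withDensity
        (fun x => ENNReal.ofReal (smoothedDensity P s (Y t) x))
        (smoothedDensity P s (Y t) ⁻¹' U)) (Icc 0 1) := by
    intro b hb c hc U hUm hlim
    refine (ENNReal.ofReal_mono.comp_monotoneOn
      (h.monotoneOn_integral_mul_indicator hs hb hc hlim)).congr fun t ht => ?_
    have hY := h.aemeasurable t ht
    have hA : MeasurableSet (smoothedDensity P s (Y t) ⁻¹' U) :=
      (continuous_smoothedDensity hs hY).measurable hUm
    rw [withDensity_apply _ hA, ← ofReal_integral_eq_lintegral_ofReal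
      (integrable_smoothedDensity hs hY).integrableOn
      (ae_of_all _ fun x => (smoothedDensity_pos hs hY x).le), ← integral_indicator hA]
    simp only [Function.comp_apply]
    congr 2 with x
    by_cases hx : smoothedDensity P s (Y t) x ∈ U
    · rw [indicator_of_mem (mem_preimage.2 hx), indicator_of_mem hx, Pi.one_apply, mul_one]
    · rw [indicator_of_notMem hx, indicator_of_notMem (by exact hx), mul_zero]
  rcases upperSet_Ioi_zero_cases hU0 hU with rfl | rfl | ⟨b, hb, rfl | rfl⟩
  · simpa using monotoneOn_const
  · have huniv : ∀ t ∈ Icc (0 : ℝ) 1, volume.withDensity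
        (fun x => ENNReal.ofReal (smoothedDensity P s (Y t) x))
        (smoothedDensity P s (Y t) ⁻¹' Ioi 0) = 1 := fun t ht => by
      have hY := h.aemeasurable t ht
      have : smoothedDensity P s (Y t) ⁻¹' Ioi 0 = univ :=
        eq_univ_of_forall fun x => smoothedDensity_pos hs hY x
      rw [this, withDensity_apply _ .univ, setLIntegral_univ, lintegral_smoothedDensity hs hY]
    exact (monotoneOn_const (c := (1 : ℝ≥0∞))).congr fun t ht => (huniv t ht).symm
  · exact key b hb 0 zero_le_one _ measurableSet_Ioi (tendsto_smoothTransition_Ioi b)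
  · exact key b hb 1 le_rfl _ measurableSet_Ici (tendsto_smoothTransition_Ici b)

/-- Layer cake for the probability measure `f dx`: since `r` is antitone, each `{r ≤ τ}` is an
up-set, whose mass grows with time, so the mass of `{r > τ}` falls. -/
theorem antitoneOn_lintegral_mul [IsProbabilityMeasure P]
    (h : IsContractingFlow P Y V S) (hs : 0 < s) {r : ℝ → ℝ} (hr : ContinuousOn r (Ioi 0))
    (hr' : AntitoneOn r (Ioi 0)) (hr0 : ∀ u > 0, 0 ≤ r u) :
    AntitoneOn (fun t => ∫⁻ x, ENNReal.ofReal
      (smoothedDensity P s (Y t) x * r (smoothedDensity P s (Y t) x))) (Icc 0 1) := by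
  intro t ht t' ht' htt'
  have hcake : ∀ t ∈ Icc (0 : ℝ) 1, ∫⁻ x, ENNReal.ofReal
      (smoothedDensity P s (Y t) x * r (smoothedDensity P s (Y t) x)) =
      ∫⁻ τ in Ioi 0, (1 - volume.withDensity
        (fun x => ENNReal.ofReal (smoothedDensity P s (Y t) x))
        (smoothedDensity P s (Y t) ⁻¹' {u | 0 < u ∧ r u ≤ τ})) := by
    intro t ht
    have hY := h.aemeasurable t ht
    have hf := continuous_smoothedDensity hs hY
    have hf0 := smoothedDensity_pos hs hY
    have hrf : Continuous fun x => r (smoothedDensity P s (Y t) x) :=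
      hr.comp_continuous hf hf0
    have hprob : IsProbabilityMeasure ((volume : Measure E).withDensity
        fun x => ENNReal.ofReal (smoothedDensity P s (Y t) x)) :=
      ⟨by rw [withDensity_apply _ .univ, setLIntegral_univ, lintegral_smoothedDensity hs hY]⟩
    have hcake := lintegral_eq_lintegral_meas_lt ((volume : Measure E).withDensity
      fun x => ENNReal.ofReal (smoothedDensity P s (Y t) x))
      (ae_of_all _ fun x => hr0 _ (hf0 x)) hrf.aemeasurable
    rw [lintegral_withDensity_eq_lintegral_mul _ hf.measurable.ennreal_ofReal
        hrf.measurable.ennreal_ofReal] at hcake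
    simp_rw [ENNReal.ofReal_mul (hf0 _).le]
    refine hcake.trans (lintegral_congr fun τ => ?_)
    have hset : {x | τ < r (smoothedDensity P s (Y t) x)} =
        (smoothedDensity P s (Y t) ⁻¹' {u | 0 < u ∧ r u ≤ τ})ᶜ := by
      ext x
      simp [hf0 x]
    have hm : MeasurableSet (smoothedDensity P s (Y t) ⁻¹' {u | 0 < u ∧ r u ≤ τ}) := by
      rw [← MeasurableSet.compl_iff, ← hset]
      exact (isOpen_lt continuous_const hrf).measurableSet
    rw [hset, prob_compl_eq_one_sub hm]
  simp only [hcake t ht, hcake t' ht']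
  refine lintegral_mono fun τ => ?_
  have hU : ∀ u ∈ {u | 0 < u ∧ r u ≤ τ}, ∀ v, u ≤ v → v ∈ {u | 0 < u ∧ r u ≤ τ} :=
    fun u hu v huv => ⟨hu.1.trans_le huv,
      (hr' (mem_Ioi.2 hu.1) (mem_Ioi.2 (hu.1.trans_le huv)) huv).trans hu.2⟩
  exact tsub_le_tsub_left (h.monotoneOn_withDensity_preimage hs (fun u hu => hu.1) hU ht ht' htt') _

theorem monotoneOn_extIntegral_comp [IsProbabilityMeasure P]
    (h : IsContractingFlow P Y V S) (hs : 0 < s) {φ : ℝ → ℝ} (hφ : ConvexOn ℝ (Ici 0) φ)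
    (h0 : φ 0 = 0) :
    MonotoneOn (fun t => extIntegral volume (fun x => φ (smoothedDensity P s (Y t) x)))
      (Icc 0 1) := by
  -- The same `M` serves all times, so the term `φ M / M` does not depend on `t`.
  obtain ⟨M, hM0, hM⟩ := exists_smoothedDensity_le_const (E := E) (P := P) hs
  have hφc : ContinuousOn φ (Ioi 0) := by
    have := hφ.continuousOn_interior
    rwa [interior_Ici] at this
  have hminpos : ∀ u ∈ Ioi (0 : ℝ), min u M ∈ Ioi (0 : ℝ) := fun u hu => lt_min hu hM0
  have hanti := h.antitoneOn_lintegral_mul hs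
    (r := fun u => φ M / M - φ (min u M) / min u M)
    (continuousOn_const.sub ((hφc.comp (by fun_prop) hminpos).div (by fun_prop)
      fun u hu => (hminpos u hu).ne'))
    (fun u hu v hv huv => sub_le_sub_left (hφ.div_le_div_of_map_zero h0 (hminpos u hu)
      (min_le_min_right M huv)) _)
    (fun u hu => sub_nonneg.2 (hφ.div_le_div_of_map_zero h0 (hminpos u hu) (min_le_right _ _)))
  intro t ht t' ht' htt'
  simp only
  rw [(extIntegral_comp_smoothedDensity hs (h.aemeasurable t ht) hφ h0 (hM _)).2,
    (extIntegral_comp_smoothedDensity hs (h.aemeasurable t' ht') hφ h0 (hM _)).2]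
  exact EReal.sub_le_sub le_rfl (EReal.coe_ennreal_le_coe_ennreal_iff.2 (hanti ht ht' htt'))

end IsContractingFlow

end Flow

/-! ### From contracting families of maps to contracting flows. -/

section Trajectories

variable {n : ℕ} {K : Set (EuclideanSpace ℝ (Fin n))}
  {T : ℝ → EuclideanSpace ℝ (Fin n) → EuclideanSpace ℝ (Fin n)}

theorem HasSmoothTrajectories.hasDerivWithinAt (hsmooth : HasSmoothTrajectories K T)
    {x : EuclideanSpace ℝ (Fin n)} (hx : x ∈ K) {t : ℝ} (ht : t ∈ Icc (0 : ℝ) 1) :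
    HasDerivWithinAt (fun τ => T τ x) (derivWithin (fun τ => T τ x) (Icc 0 1) t) (Icc 0 1) t :=
  ((hsmooth x hx).differentiableOn (by simp) t ht).hasDerivWithinAt

theorem HasSmoothTrajectories.continuousOn_derivWithin (hsmooth : HasSmoothTrajectories K T)
    {x : EuclideanSpace ℝ (Fin n)} (hx : x ∈ K) :
    ContinuousOn (derivWithin (fun τ => T τ x) (Icc 0 1)) (Icc 0 1) :=
  (hsmooth x hx).continuousOn_derivWithin (uniqueDiffOn_Icc zero_lt_one) (by simp)

/-- Comparison with time `0` shows that `T t` is `1`-Lipschitz on `K`, hence extends. The extension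
supplies measurability, with none assumed of `K` or `T t`. -/
theorem IsContinuouslyContracting.exists_continuous_eqOn (hT : IsContinuouslyContracting K T)
    {t : ℝ} (ht : t ∈ Icc (0 : ℝ) 1) :
    ∃ g : EuclideanSpace ℝ (Fin n) → EuclideanSpace ℝ (Fin n), Continuous g ∧ EqOn (T t) g K := by
  have hlip : LipschitzOnWith 1 (T t) K := LipschitzOnWith.of_dist_le_mul fun x hx y hy => by
    have h := hT.antitone_dist x hx y hy (left_mem_Icc.2 zero_le_one) ht ht.1
    simpa [dist_eq_norm, hT.start x hx, hT.start y hy] using h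
  obtain ⟨g, hg, hgT⟩ := hlip.extend_finite_dimension
  exact ⟨g, hg.continuous, hgT⟩

/-- The derivative is a limit of measurable difference quotients; the value `0` outside `I` is a
filler that the filter ignores. -/
theorem aemeasurable_of_hasDerivWithinAt {E : Type*} [NormedAddCommGroup E] [NormedSpace ℝ E]
    [FiniteDimensional ℝ E] [MeasurableSpace E] [BorelSpace E] {Ω : Type*} [MeasurableSpace Ω]
    {P : Measure Ω} {Y : ℝ → Ω → E} {V : Ω → E} {I : Set ℝ} {t : ℝ}
    (hI : UniqueDiffWithinAt ℝ I t) (ht : t ∈ I) (hY : ∀ r ∈ I, AEMeasurable (Y r) P)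
    (hV : ∀ ω, HasDerivWithinAt (fun r => Y r ω) (V ω) I t) : AEMeasurable V P := by
  classical
  have hne : (𝓝[I \ {t}] t).NeBot := by
    have := uniqueDiffWithinAt_iff_accPt.1 hI
    rwa [accPt_principal_iff_nhdsWithin] at this
  refine aemeasurable_of_tendsto_metrizable_ae (𝓝[I \ {t}] t)
    (f := fun r ω => if r ∈ I then slope (fun r => Y r ω) t r else 0) (fun r => ?_)
    (ae_of_all _ fun ω => ?_)
  · by_cases hr : r ∈ I
    · simp only [hr, if_true, slope, vsub_eq_sub]
      exact ((hY r hr).sub (hY t ht)).const_smul _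
    · simp only [hr, if_false]
      exact aemeasurable_const
  · refine (hasDerivWithinAt_iff_tendsto_slope.1 (hV ω)).congr' ?_
    filter_upwards [self_mem_nhdsWithin] with r hr
    rw [if_pos hr.1]

/-- The inner product is half the derivative of the squared distance. -/
theorem inner_sub_nonpos_of_antitoneOn_norm_sub {E : Type*} [NormedAddCommGroup E]
    [InnerProductSpace ℝ E] {y y' : ℝ → E} {v v' : E} {I : Set ℝ} {t : ℝ}
    (hI : UniqueDiffWithinAt ℝ I t) (hy : HasDerivWithinAt y v I t)
    (hy' : HasDerivWithinAt y' v' I t) (hanti : AntitoneOn (fun t => ‖y t - y' t‖) I) :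
    ⟪y t - y' t, v - v'⟫_ℝ ≤ 0 := by
  have h1 := (hy.sub hy').norm_sq
  have h2 : AntitoneOn (fun t => ‖(y - y') t‖ ^ 2) I := fun a ha b hb hab =>
    pow_le_pow_left₀ (norm_nonneg _) (hanti ha hb hab) 2
  have h3 := h2.derivWithin_nonpos (x := t)
  rw [h1.derivWithin hI] at h3
  simp only [Pi.sub_apply] at h3
  linarith

theorem exists_isContractingFlow (hT : IsContinuouslyContracting K T)
    (hsmooth : HasSmoothTrajectories K T) {Ω : Type*} [MeasurableSpace Ω] {P : Measure Ω}
    {X : Ω → EuclideanSpace ℝ (Fin n)} (hX : AEMeasurable X P) (hXK : ∀ ω, X ω ∈ K)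
    (hXint : ∫⁻ ω, ‖X ω‖ₑ ∂P < ∞)
    (hspeed : ∫⁻ ω, ⨆ t ∈ Icc (0 : ℝ) 1,
      ‖derivWithin (fun τ => T τ (X ω)) (Icc 0 1) t‖ₑ ∂P < ∞) :
    ∃ V S, IsContractingFlow P (fun t ω => T t (X ω)) V S := by
  have hU : ∀ t ∈ Icc (0 : ℝ) 1, UniqueDiffWithinAt ℝ (Icc (0 : ℝ) 1) t :=
    uniqueDiffOn_Icc zero_lt_one
  set V : ℝ → Ω → EuclideanSpace ℝ (Fin n) :=
    fun t ω => derivWithin (fun τ => T τ (X ω)) (Icc 0 1) t with hVdef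
  have hVd : ∀ ω, ∀ t ∈ Icc (0 : ℝ) 1,
      HasDerivWithinAt (fun τ => T τ (X ω)) (V t ω) (Icc 0 1) t := fun ω t ht =>
    hsmooth.hasDerivWithinAt (hXK ω) ht
  have hY : ∀ t ∈ Icc (0 : ℝ) 1, AEMeasurable (fun ω => T t (X ω)) P := fun t ht => by
    obtain ⟨g, hg, hgT⟩ := hT.exists_continuous_eqOn ht
    exact (hg.measurable.comp_aemeasurable hX).congr (ae_of_all _ fun ω => (hgT (hXK ω)).symm)
  have hVm : ∀ t ∈ Icc (0 : ℝ) 1, AEMeasurable (V t) P := fun t ht =>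
    aemeasurable_of_hasDerivWithinAt (hU t ht) ht hY fun ω => hVd ω t ht
  have hne : Nonempty (Icc (0 : ℝ) 1) := ⟨⟨0, by simp⟩⟩
  -- A countable supremum is measurable, and continuity of the velocity in time extends its bound to
  -- every `t`.
  set d := TopologicalSpace.denseSeq (Icc (0 : ℝ) 1) with hd
  set S : Ω → ℝ≥0∞ := fun ω => ⨆ k, ‖V (d k) ω‖ₑ with hS
  have hSm : AEMeasurable S P := .iSup fun k => (hVm _ (d k).2).enorm
  have hVS : ∀ ω, ∀ t : Icc (0 : ℝ) 1, ‖V t ω‖ₑ ≤ S ω := fun ω t => by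
    have hc : Continuous fun t : Icc (0 : ℝ) 1 => ‖V t ω‖ₑ :=
      (continuousOn_iff_continuous_domRestrict.1 (hsmooth.continuousOn_derivWithin (hXK ω))).enorm
    exact (TopologicalSpace.denseRange_denseSeq _).induction_on 
      (p := fun t : Icc (0 : ℝ) 1 => ‖V t ω‖ₑ ≤ S ω) t
      (isClosed_le hc continuous_const) fun k => le_iSup (fun k => ‖V (d k) ω‖ₑ) k
  have hSsup : ∀ ω, S ω ≤ ⨆ t ∈ Icc (0 : ℝ) 1,
      ‖derivWithin (fun τ => T τ (X ω)) (Icc 0 1) t‖ₑ := fun ω =>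
    iSup_le fun k => le_iSup₂_of_le (d k : ℝ) (d k).2 le_rfl
  -- Finiteness for every `ω`, not just almost every one, keeps `toReal` a valid pointwise bound; it
  -- comes from compactness of `[0, 1]`.
  have hSfin : ∀ ω, S ω ≠ ∞ := fun ω => by
    obtain ⟨C, hC⟩ := isCompact_Icc.exists_bound_of_continuousOn
      (hsmooth.continuousOn_derivWithin (hXK ω))
    refine ne_top_of_le_ne_top (b := ENNReal.ofReal C) ENNReal.ofReal_ne_top (iSup_le fun k => ?_)
    rw [← ofReal_norm]
    exact ENNReal.ofReal_le_ofReal (hC _ (d k).2)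
  have hSint : Integrable (fun ω => (S ω).toReal) P :=
    integrable_toReal_of_lintegral_ne_top hSm
      (((lintegral_mono hSsup).trans_lt hspeed).ne)
  have hVle : ∀ ω, ∀ t ∈ Icc (0 : ℝ) 1, ‖V t ω‖ ≤ (S ω).toReal := fun ω t ht => by
    rw [← toReal_enorm]
    exact ENNReal.toReal_mono (hSfin ω) (hVS ω ⟨t, ht⟩)
  refine ⟨V, fun ω => (S ω).toReal, hY, fun t ht => hSint.mono' (hVm t ht).aestronglyMeasurable
    (ae_of_all _ fun ω => hVle ω t ht), hVd, hVle, hSint, ?_, fun t ht ω ω' =>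
      inner_sub_nonpos_of_antitoneOn_norm_sub (hU t ht) (hVd ω t ht) (hVd ω' t ht)
        (hT.antitone_dist _ (hXK ω) _ (hXK ω'))⟩
  have : (fun ω => T 0 (X ω)) = X := funext fun ω => hT.start _ (hXK ω)
  simp only [this]
  exact ⟨hX.aestronglyMeasurable, hXint⟩

end Trajectories

/-! ### Identification of the density and the main theorem. -/

theorem density_add_sqrt_smul_ae_eq {Ω : Type*} [MeasurableSpace Ω] {P : Measure Ω}
    [IsProbabilityMeasure P] {n : ℕ} {Y Z : Ω → EuclideanSpace ℝ (Fin n)} {s : ℝ} (hs : 0 < s)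
    (hY : AEMeasurable Y P) (hZ : HasLaw Z (stdGaussian (EuclideanSpace ℝ (Fin n))) P)
    (hYZ : IndepFun Y Z P) :
    HasPDF (fun ω => Y ω + √s • Z ω) P volume ∧
      density P (fun ω => Y ω + √s • Z ω) =ᵐ[volume] smoothedDensity P s Y := by
  have hm : Measurable fun x => ENNReal.ofReal (smoothedDensity P s Y x) :=
    (continuous_smoothedDensity hs hY).measurable.ennreal_ofReal
  have hmap := map_add_sqrt_smul_stdGaussian hs hY hZ hYZ
  have hpdf : HasPDF (fun ω => Y ω + √s • Z ω) P volume :=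
    hasPDF_of_map_eq_withDensity
      (hY.add (hZ.aemeasurable.const_smul (√s))) _ hm.aemeasurable hmap
  refine ⟨hpdf, ?_⟩
  filter_upwards [(pdf.eq_of_map_eq_withDensity' _ hm.aemeasurable).1 hmap] with x hx
  rw [density, hx, ENNReal.toReal_ofReal (smoothedDensity_pos hs hY x).le]

theorem mainTheorem2 {n : ℕ} {K : Set (EuclideanSpace ℝ (Fin n))}
    {T : ℝ → EuclideanSpace ℝ (Fin n) → EuclideanSpace ℝ (Fin n)}
    (hT : IsContinuouslyContracting K T) (hsmooth : HasSmoothTrajectories K T)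
    {Ω : Type*} [MeasurableSpace Ω] {P : Measure Ω} [IsProbabilityMeasure P]
    {X Z : Ω → EuclideanSpace ℝ (Fin n)}
    (hX : AEMeasurable X P) (hXK : ∀ᵐ ω ∂P, X ω ∈ K)
    (hXint : ∫⁻ ω, ‖X ω‖ₑ ∂P < ∞)
    (hspeed : ∫⁻ ω, ⨆ t ∈ Icc (0 : ℝ) 1,
      ‖derivWithin (fun τ => T τ (X ω)) (Icc 0 1) t‖ₑ ∂P < ∞)
    (hZ : HasLaw Z (stdGaussian (EuclideanSpace ℝ (Fin n))) P) (hXZ : IndepFun X Z P)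
    {s : ℝ} (hs : 0 < s) :
    (∀ t ∈ Icc (0 : ℝ) 1, HasPDF (fun ω => T t (X ω) + √s • Z ω) P volume) ∧
    ∀ φ : ℝ → ℝ, ConvexOn ℝ (Ici 0) φ → φ 0 = 0 →
      (∀ t ∈ Icc (0 : ℝ) 1,
        ∫⁻ x, ENNReal.ofReal (φ (density P (fun ω => T t (X ω) + √s • Z ω) x)) < ∞) ∧
      MonotoneOn
        (fun t => extIntegral volume
          (fun x => φ (density P (fun ω => T t (X ω) + √s • Z ω) x)))
        (Icc 0 1) := by
  classical
  obtain ⟨ω₀, hω₀⟩ := hXK.exists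
  -- A contracting flow is required to behave for every `ω`, so `X` is altered on a null set to take
  -- values in `K` everywhere.
  obtain ⟨X', hX'K, hX'⟩ : ∃ X' : Ω → EuclideanSpace ℝ (Fin n), (∀ ω, X' ω ∈ K) ∧ X =ᵐ[P] X' := by
    refine ⟨fun ω => if X ω ∈ K then X ω else X ω₀, fun ω => ?_, ?_⟩
    · dsimp only
      split_ifs with h
      exacts [h, hω₀]
    · filter_upwards [hXK] with ω hω
      rw [if_pos hω]
  obtain ⟨V, S, h⟩ := exists_isContractingFlow hT hsmooth (hX.congr hX') hX'K
    ((lintegral_congr_ae (hX'.mono fun ω hω => by simp only [hω])).symm.trans_lt hXint)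
    ((lintegral_congr_ae (hX'.mono fun ω hω => by simp only [hω])).symm.trans_lt hspeed)
  have hcongr : ∀ t, (fun ω => T t (X' ω) + √s • Z ω) =ᵐ[P] fun ω => T t (X ω) + √s • Z ω :=
    fun t => hX'.mono fun ω hω => by simp only [hω]
  -- Independence is passed on through the continuous extension, as `T t` itself need not be
  -- measurable.
  have hind : ∀ t ∈ Icc (0 : ℝ) 1, IndepFun (fun ω => T t (X' ω)) Z P := fun t ht => by
    obtain ⟨g, hg, hgT⟩ := hT.exists_continuous_eqOn ht
    refine (hXZ.comp hg.measurable measurable_id).congr (hX'.mono fun ω hω => ?_) (ae_eq_refl _)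
    rw [Function.comp_apply, hω]
    exact (hgT (hX'K ω)).symm
  have hd : ∀ t ∈ Icc (0 : ℝ) 1, HasPDF (fun ω => T t (X ω) + √s • Z ω) P volume ∧
      density P (fun ω => T t (X ω) + √s • Z ω) =ᵐ[volume]
        smoothedDensity P s (fun ω => T t (X' ω)) := fun t ht => by
    have h1 := density_add_sqrt_smul_ae_eq hs (h.aemeasurable t ht) hZ (hind t ht)
    refine ⟨(HasPDF.congr_iff (hcongr t)).1 h1.1, ?_⟩
    have : density P (fun ω => T t (X ω) + √s • Z ω) =
        density P (fun ω => T t (X' ω) + √s • Z ω) := by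
      unfold density
      rw [pdf.congr (hcongr t)]
    rw [this]
    exact h1.2
  refine ⟨fun t ht => (hd t ht).1, fun φ hφ h0 => ⟨fun t ht => ?_, ?_⟩⟩
  · obtain ⟨M, -, hM⟩ := exists_smoothedDensity_le_const (E := EuclideanSpace ℝ (Fin n))
      (P := P) hs
    refine (lintegral_congr_ae ((hd t ht).2.mono fun x hx => by simp only [hx])).trans_lt
      (extIntegral_comp_smoothedDensity hs (h.aemeasurable t ht) hφ h0 (hM _)).1
  · exact (h.monotoneOn_extIntegral_comp hs hφ h0).congr fun t ht =>
      extIntegral_congr_ae ((hd t ht).2.symm.mono fun x hx => by simp only [hx])
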